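/- **Setting.** An input $\sigma$ of open, non-preemptive Dial-a-Ride on the line is a finite family of requests $(a_i,b_i;r_i)$, $a_i,b_i\in\mathbb{R}$, $r_i\ge 0$. Request $i$ appears at time $r_i$ at position $a_i$ and has to be transported to position $b_i$. A server with capacity $c\in\{1,2,\dots\}\cup\{\infty\}$ starts at the origin at time $0$ and moves with at most unit speed. It may pick up a request at its position $a_i$ at any time from $r_i$ on, carries at most $c$ requests at once, unloads a request only at its destination $b_i$, and need not return to the origin. For $t\ge 0$, $p\in\mathbb{R}$ and a set $R$ of requests, $L(t,p,R)$ denotes the minimum length (duration, including waiting) of a schedule that starts with the empty server at position $p$ at time $t$ and serves all requests in $R$, respecting release times. Let $\mathrm{OPT}(\sigma)=L(0,0,\sigma)$. For $\Theta>1$, the online algorithm $\mathrm{Smartstart}_\Theta$ works as follows. Whenever the server is idle, at position $p$ at time $t$, and not all requests have been served, let $R_{t'}$ be the set of unserved requests that have appeared until time $t'$. The server waits at $p$ until the first time $t'\ge t$ with $R_{t'}\neq\emptyset$ and $L(t',p,R_{t'})/(\Theta-1)\le t'$. It then executes an optimal schedule for $R_{t'}$ starting from $p$, ignoring requests that appear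 meanwhile, and is idle again at the end of this schedule. $\mathrm{Smartstart}_\Theta(\sigma)$ is the time at which all requests have been served. Ties between optimal schedules may be broken in any way. The competitive ratio of the algorithm is the infimum of all $\rho\in[0,\infty]$ such that $\mathrm{Smartstart}_\Theta(\sigma)\le\rho\cdot\mathrm{OPT}(\sigma)$ for all inputs $\sigma$. Let $$f_1(\Theta)=\frac{2\Theta^2+2\Theta}{\Theta^2+\Theta-2},\qquad f_2(\Theta)=\Theta+1-\frac{\Theta-1}{3\Theta+3}.$$ **Theorem.** The equation $f_1(\Theta)=f_2(\Theta)$ has exactly one positive real solution $\Theta^*$. With $\rho^*:=f_1(\Theta^*)=f_2(\Theta^*)$, it satisfies $|\Theta^*-2.0526|<5\cdot 10^{-5}$ and $|\rho^*-2.93768|<5\cdot 10^{-6}$. Moreover, for every capacity $c\in\{1,2,\dots\}\cup\{\infty\}$, the following hold. 1. For every $\Theta>1$, $\mathrm{Smartstart}_\Theta$ is well defined: on every input the waiting times and optimal schedules above exist, and all requests are eventually served. 2. The competitive ratio of $\mathrm{Smartstart}_{\Theta^*}$ is exactly $\rho^*$, however ties are broken. 3. For every $\Theta>1$ with $\Theta\neq\Theta^*$,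 the competitive ratio of $\mathrm{Smartstart}_\Theta$ is strictly larger than $\rho^*$, however ties are broken. -/

import Mathlib

noncomputable section

namespace DialARide

open scoped ENNReal

/-- A transportation request `(src, dst; rel)`: it appears at time `rel` at position `src` of the
real line and has to be transported to position `dst`. -/
structure Request where
  src : ℝ
  dst : ℝ
  rel : ℝ
  rel_nonneg : 0 ≤ rel

/-- A finite family of requests. -/
structure Input where
  n : ℕ
  req : Fin n → Request

/-- A stop of the server: it either picks up or delivers a request. -/
inductive Stop (ι : Type)
  | pickup (i : ι)
  | dropoff (i : ι)

/-- The position at which a stop takes place. -/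
def Stop.pos (σ : Input) : Stop (Fin σ.n) → ℝ
  | .pickup i => (σ.req i).src
  | .dropoff i => (σ.req i).dst

/-- A list of stops, each with the time at which it takes place, in the order of execution. -/
abbrev Plan (σ : Input) := List (ℝ × Stop (Fin σ.n))

/-- `IsSchedule c σ t p W B S`: a server of capacity `c` that is at position `p` at time `t` and has
the requests in `B` on board can execute `S`, and thereby picks up every request of `W`
(each not before its release) and delivers every request of `W ∪ B`.
The server has at most unit speed (it may wait anywhere), carries at most `c` requests at once,
and a request that was picked up is unloaded only at its destination (no preemption). -/
def IsSchedule (c : ℕ∞) (σ : Input) :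
    ℝ → ℝ → Finset (Fin σ.n) → Finset (Fin σ.n) → Plan σ → Prop
  | _, _, W, B, [] => W = ∅ ∧ B = ∅
  | t, p, W, B, (s, .pickup i) :: S =>
      i ∈ W ∧ (B.card : ℕ∞) + 1 ≤ c ∧
      t + |(σ.req i).src - p| ≤ s ∧ (σ.req i).rel ≤ s ∧
      IsSchedule c σ s (σ.req i).src (W.erase i) (insert i B) S
  | t, p, W, B, (s, .dropoff i) :: S =>
      i ∈ B ∧
      t + |(σ.req i).dst - p| ≤ s ∧
      IsSchedule c σ s (σ.req i).dst W (B.erase i) S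

/-- The time at which a schedule that is begun at time `t` is completed. -/
def endTime {σ : Input} : ℝ → Plan σ → ℝ
  | t, [] => t
  | _, (s, _) :: S => endTime s S

/-- The position at which a schedule that is begun at position `p` ends. -/
def endPos {σ : Input} : ℝ → Plan σ → ℝ
  | p, [] => p
  | _, (_, e) :: S => endPos (e.pos σ) S

/-- `L(t, p, R)`: the length (duration, waiting included) of a shortest open schedule that starts at
position `p` at time `t` with an empty server and serves all requests of `R`, respecting release
times. -/
def L (c : ℕ∞) (σ : Input) (t p : ℝ) (R : Finset (Fin σ.n)) : ℝ :=
  sInf {ℓ | ∃ S : Plan σ, IsSchedule c σ t p R ∅ S ∧ ℓ = endTime t S - t}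

/-- The offline optimum. -/
def opt (c : ℕ∞) (σ : Input) : ℝ := L c σ 0 0 Finset.univ

/-- `R_t`: the requests among the not yet served ones `U` that have appeared until time `t`. -/
def pending (σ : Input) (U : Finset (Fin σ.n)) (t : ℝ) : Finset (Fin σ.n) :=
  U.filter fun i => (σ.req i).rel ≤ t

/-- `SmartstartRun c Θ σ t p U T`: from the situation in which the server is idle and empty at
position `p` at time `t` and the requests in `U` are not yet served (some of them may not have
appeared yet), a run of Smartstart with parameter `Θ` can complete all requests at time `T`.
As long as requests remain, Smartstart waits at `p` for the first time `s ≥ t` at which there are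
pending requests and `L(s, p, R_s) / (Θ - 1) ≤ s`; it then executes some optimal schedule for
`R_s`, ignoring what appears meanwhile, and continues from where this schedule ends. -/
inductive SmartstartRun (c : ℕ∞) (Θ : ℝ) (σ : Input) : ℝ → ℝ → Finset (Fin σ.n) → ℝ → Prop
  | done (t p : ℝ) : SmartstartRun c Θ σ t p ∅ t
  | step (t p : ℝ) (U : Finset (Fin σ.n)) (s : ℝ) (S : Plan σ) (T : ℝ)
      (start : IsLeast {s' | t ≤ s' ∧ (pending σ U s').Nonempty ∧
        L c σ s' p (pending σ U s') / (Θ - 1) ≤ s'} s)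
      (sched : IsSchedule c σ s p (pending σ U s) ∅ S)
      (optimal : endTime s S - s = L c σ s p (pending σ U s))
      (rest : SmartstartRun c Θ σ (endTime s S) (endPos p S) (U \ pending σ U s) T) :
      SmartstartRun c Θ σ t p U T

/-- `A` assigns to every input the completion time of Smartstart with parameter `Θ`, for some way
of choosing among several optimal schedules. -/
def IsSmartstart (c : ℕ∞) (Θ : ℝ) (A : Input → ℝ) : Prop :=
  ∀ σ : Input, SmartstartRun c Θ σ 0 0 Finset.univ (A σ)

/-- The competitive ratio of an algorithm with cost function `A`: the infimum of all `ρ` such that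
`A(σ) ≤ ρ · opt(σ)` for every input `σ` (infinite if there is no such `ρ`). -/
def competitiveRatio (c : ℕ∞) (A : Input → ℝ) : ℝ≥0∞ :=
  sInf {ρ | ∀ σ : Input, ENNReal.ofReal (A σ) ≤ ρ * ENNReal.ofReal (opt c σ)}

def f₁ (Θ : ℝ) : ℝ := (2 * Θ ^ 2 + 2 * Θ) / (Θ ^ 2 + Θ - 2)

def f₂ (Θ : ℝ) : ℝ := Θ + 1 - (Θ - 1) / (3 * Θ + 3)

end DialARide

end

/-! Upper bound, for `Θ ≥ 2`. The tool is imitation: once the requests of a set `P` have appeared, a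
server anywhere can drive to where the offline optimum makes its first pickup from `P` and copy it
from there (`IsSchedule.exists_follow`). A schedule of Smartstart started at time `s` ends by `Θ *
s`, so the distance of its end from the origin is at most `Θ` times the release time of every
request then unserved. Imitation from such a position `p` costs at most `(2Θ+2)/(Θ+2)` times the
optimum (`L_le_opt`). By `start_cases` the last schedule starts in one of three ways. If the waiting
condition is tight, it ends at `Θ * s = Θ/(Θ-1) * L`, which is at most `f₁ Θ` times the optimum. If
a request has just appeared, then `s` is at most the optimum and the ratio stays below `f₂ Θ`. If it
follows its predecessor without waiting, the two are bounded together by `f₂ Θ`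
(`add_L_le_of_no_wait`).

Lower bounds. Point requests at `q^(k+1) - 1`, released at `q^k`, pull the server away from the
origin at almost full speed: it stands at `q^K - 1` at time `q^K`, although the last of them
appeared at `q^(K-1)` (`SmartstartRun.runaway`). From there, a chain of rides starting on the far
side of the origin forces `f₁ Θ` in the limit (`shuttle`). A decoy that sends the server to the left
just before a request appears far to the right forces `f₂ Θ` for `2 ≤ Θ ≤ 9/4` in the limit, and
more than `ρ*` for larger `Θ` (`decoy`).

On `(1, ∞)` the function `f₁` decreases and `f₂` increases strictly, so their crossing is the unique
best parameter. -/

namespace DialARide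

/-! ### Schedules: elementary estimates and manipulations -/

open Finset

variable {c : ℕ∞} {σ : Input} {t t' p q s : ℝ} {W B P : Finset (Fin σ.n)} {S : Plan σ}

/-- The request concerned by a stop. -/
def Stop.idx {ι : Type} : Stop ι → ι
  | .pickup i => i
  | .dropoff i => i

theorem isSchedule_nil : IsSchedule c σ t p W B [] ↔ W = ∅ ∧ B = ∅ := by
  simp only [IsSchedule]

theorem isSchedule_pickup {i : Fin σ.n} :
    IsSchedule c σ t p W B ((s, .pickup i) :: S) ↔
      i ∈ W ∧ (B.card : ℕ∞) + 1 ≤ c ∧ t + |(σ.req i).src - p| ≤ s ∧ (σ.req i).rel ≤ s ∧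
        IsSchedule c σ s (σ.req i).src (W.erase i) (insert i B) S := by
  simp only [IsSchedule]

theorem isSchedule_dropoff {i : Fin σ.n} :
    IsSchedule c σ t p W B ((s, .dropoff i) :: S) ↔
      i ∈ B ∧ t + |(σ.req i).dst - p| ≤ s ∧
        IsSchedule c σ s (σ.req i).dst W (B.erase i) S := by
  simp only [IsSchedule]

namespace IsSchedule

theorem head_le {e : Stop (Fin σ.n)} (h : IsSchedule c σ t p W B ((s, e) :: S)) :
    t + |e.pos σ - p| ≤ s := by
  cases e with
  | pickup i => exact (isSchedule_pickup.1 h).2.2.1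
  | dropoff i => exact (isSchedule_dropoff.1 h).2.1

theorem tail {e : Stop (Fin σ.n)} (h : IsSchedule c σ t p W B ((s, e) :: S)) :
    ∃ W' B', IsSchedule c σ s (e.pos σ) W' B' S := by
  cases e with
  | pickup i => exact ⟨_, _, (isSchedule_pickup.1 h).2.2.2.2⟩
  | dropoff i => exact ⟨_, _, (isSchedule_dropoff.1 h).2.2⟩

/-- The start of a schedule may be replaced by a situation from which the first stop is reached
in time. -/
theorem change_start {e : Stop (Fin σ.n)} (h : IsSchedule c σ t p W B ((s, e) :: S))
    (hq : t' + |e.pos σ - q| ≤ s) : IsSchedule c σ t' q W B ((s, e) :: S) := by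
  cases e with
  | pickup i =>
    rw [isSchedule_pickup] at h ⊢
    exact ⟨h.1, h.2.1, hq, h.2.2.2⟩
  | dropoff i =>
    rw [isSchedule_dropoff] at h ⊢
    exact ⟨h.1, hq, h.2.2⟩

theorem of_move (h : IsSchedule c σ t' q W B S) (hq : t + |q - p| ≤ t') :
    IsSchedule c σ t p W B S := by
  rcases S with _ | ⟨⟨s, e⟩, S⟩
  · rw [isSchedule_nil] at h ⊢; exact h
  · refine h.change_start ?_
    have h1 := h.head_le
    have h2 := abs_sub_le (e.pos σ) q p
    linarith

theorem le_of_mem (h : IsSchedule c σ t p W B S) {v : ℝ} {e : Stop (Fin σ.n)} (he : (v, e) ∈ S) :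
    t + |e.pos σ - p| ≤ v := by
  induction S generalizing t p W B with
  | nil => simp at he
  | cons a S ih =>
    obtain ⟨s, e'⟩ := a
    have h1 := h.head_le
    rcases List.mem_cons.1 he with he | he
    · cases he; exact h1
    · obtain ⟨W', B', h'⟩ := h.tail
      have h2 := ih h' he
      have h3 := abs_sub_le (e.pos σ) (e'.pos σ) p
      linarith

theorem dist_endPos_le (h : IsSchedule c σ t p W B S) :
    t + |endPos p S - p| ≤ endTime t S := by
  induction S generalizing t p W B with
  | nil => simp [endPos, endTime]
  | cons a S ih =>
    obtain ⟨s, e⟩ := a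
    obtain ⟨W', B', h'⟩ := h.tail
    have h1 := h.head_le
    have h2 := ih h'
    have h3 := abs_sub_le (endPos (e.pos σ) S) (e.pos σ) p
    simp only [endPos, endTime]
    linarith

theorem le_endTime (h : IsSchedule c σ t p W B S) : t ≤ endTime t S := by
  have := h.dist_endPos_le
  have := abs_nonneg (endPos p S - p)
  linarith

theorem endTime_ge_of_mem (h : IsSchedule c σ t p W B S) {v : ℝ} {e : Stop (Fin σ.n)}
    (he : (v, e) ∈ S) : v + |endPos p S - e.pos σ| ≤ endTime t S := by
  induction S generalizing t p W B with
  | nil => simp at he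
  | cons a S ih =>
    obtain ⟨s, e'⟩ := a
    obtain ⟨W', B', h'⟩ := h.tail
    rcases List.mem_cons.1 he with he | he
    · cases he; exact h'.dist_endPos_le
    · exact ih h' he

theorem dist_le_of_mem (h : IsSchedule c σ t p W B S) {v v' : ℝ} {e e' : Stop (Fin σ.n)}
    (he : (v, e) ∈ S) (he' : (v', e') ∈ S) : |e.pos σ - e'.pos σ| ≤ |v - v'| := by
  induction S generalizing t p W B with
  | nil => simp at he
  | cons a S ih =>
    obtain ⟨s, f⟩ := a
    obtain ⟨W', B', h'⟩ := h.tail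
    rcases List.mem_cons.1 he with hm | hm <;> rcases List.mem_cons.1 he' with hm' | hm'
    · cases hm; cases hm'; simp
    · cases hm
      have := h'.le_of_mem hm'
      rw [abs_sub_comm, abs_sub_comm v]
      exact (by linarith : _ ≤ v' - v).trans (le_abs_self _)
    · cases hm'
      have := h'.le_of_mem hm
      exact (by linarith : _ ≤ v - v').trans (le_abs_self _)
    · exact ih h' hm hm'

theorem exists_dropoff (h : IsSchedule c σ t p W B S) {i : Fin σ.n} (hi : i ∈ B) :
    ∃ v, (v, .dropoff i) ∈ S := by
  induction S generalizing t p W B with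
  | nil => rw [isSchedule_nil] at h; simp [h.2] at hi
  | cons a S ih =>
    obtain ⟨s, j | j⟩ := a
    · obtain ⟨v, hv⟩ := ih (isSchedule_pickup.1 h).2.2.2.2 (mem_insert_of_mem hi)
      exact ⟨v, List.mem_cons_of_mem _ hv⟩
    · by_cases hij : i = j
      · subst hij; exact ⟨s, List.mem_cons_self⟩
      · obtain ⟨v, hv⟩ := ih (isSchedule_dropoff.1 h).2.2 (mem_erase.2 ⟨hij, hi⟩)
        exact ⟨v, List.mem_cons_of_mem _ hv⟩

theorem exists_stops (h : IsSchedule c σ t p W B S) {i : Fin σ.n} (hi : i ∈ W) :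
    ∃ u v, (u, .pickup i) ∈ S ∧ (v, .dropoff i) ∈ S ∧ (σ.req i).rel ≤ u ∧
      u + |(σ.req i).dst - (σ.req i).src| ≤ v := by
  induction S generalizing t p W B with
  | nil => rw [isSchedule_nil] at h; simp [h.1] at hi
  | cons a S ih =>
    obtain ⟨s, j | j⟩ := a
    · have h' := isSchedule_pickup.1 h
      by_cases hij : i = j
      · subst hij
        obtain ⟨v, hv⟩ := h'.2.2.2.2.exists_dropoff (mem_insert_self i B)
        exact ⟨s, v, List.mem_cons_self, List.mem_cons_of_mem _ hv, h'.2.2.2.1,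
          h'.2.2.2.2.le_of_mem hv⟩
      · obtain ⟨u, v, hu, hv, huv⟩ := ih h'.2.2.2.2 (mem_erase.2 ⟨hij, hi⟩)
        exact ⟨u, v, List.mem_cons_of_mem _ hu, List.mem_cons_of_mem _ hv, huv⟩
    · obtain ⟨u, v, hu, hv, huv⟩ := ih (isSchedule_dropoff.1 h).2.2 hi
      exact ⟨u, v, List.mem_cons_of_mem _ hu, List.mem_cons_of_mem _ hv, huv⟩

/-- A schedule that serves some request ends with a delivery. -/
theorem exists_last (h : IsSchedule c σ t p W B S) (hne : (W ∪ B).Nonempty) :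
    ∃ i ∈ W ∪ B, (endTime t S, .dropoff i) ∈ S ∧ endPos p S = (σ.req i).dst := by
  induction S generalizing t p W B with
  | nil => rw [isSchedule_nil] at h; simp [h.1, h.2] at hne
  | cons a S ih =>
    obtain ⟨s, j | j⟩ := a
    · have h' := isSchedule_pickup.1 h
      obtain ⟨i, hi, hl, he⟩ := ih h'.2.2.2.2 ⟨j, by simp⟩
      refine ⟨i, ?_, List.mem_cons_of_mem _ hl, he⟩
      simp only [mem_union, mem_erase, mem_insert] at hi ⊢
      rcases hi with hi | rfl | hi
      exacts [Or.inl hi.2, Or.inl h'.1, Or.inr hi]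
    · have h' := isSchedule_dropoff.1 h
      by_cases hn : (W ∪ B.erase j).Nonempty
      · obtain ⟨i, hi, hl, he⟩ := ih h'.2.2 hn
        refine ⟨i, ?_, List.mem_cons_of_mem _ hl, he⟩
        simp only [mem_union, mem_erase] at hi ⊢
        exact hi.imp_right And.right
      · rcases S with _ | ⟨⟨s', k | k⟩, S⟩
        · exact ⟨j, mem_union_right _ h'.1, by simp [endTime], rfl⟩
        · exact absurd ⟨k, mem_union_left _ (isSchedule_pickup.1 h'.2.2).1⟩ hn
        · exact absurd ⟨k, mem_union_right _ (isSchedule_dropoff.1 h'.2.2).1⟩ hn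

/-- Skipping the stops of requests outside `P` never increases the load, and the triangle inequality
keeps all remaining times feasible. -/
theorem restrict (h : IsSchedule c σ t p W B S) (P : Finset (Fin σ.n)) :
    IsSchedule c σ t p (W ∩ P) (B ∩ P) (S.filter fun a => a.2.idx ∈ P) := by
  induction S generalizing t p W B with
  | nil => rw [isSchedule_nil] at h; simp [isSchedule_nil, h.1, h.2]
  | cons a S ih =>
    obtain ⟨s, j | j⟩ := a
    · have h' := isSchedule_pickup.1 h
      have h2 := ih h'.2.2.2.2
      by_cases hj : j ∈ P
      · rw [List.filter_cons_of_pos (by exact decide_eq_true hj), isSchedule_pickup]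
        refine ⟨mem_inter.2 ⟨h'.1, hj⟩, le_trans ?_ h'.2.1, h'.2.2.1, h'.2.2.2.1, ?_⟩
        · gcongr; exact inter_subset_left
        · rwa [erase_inter, insert_inter_of_mem hj] at h2
      · rw [List.filter_cons_of_neg (by exact fun h => hj (of_decide_eq_true h))]
        rw [erase_inter, insert_inter_of_notMem hj, erase_eq_of_notMem (by simp [hj])] at h2
        exact h2.of_move h'.2.2.1
    · have h' := isSchedule_dropoff.1 h
      have h2 := ih h'.2.2
      by_cases hj : j ∈ P
      · rw [List.filter_cons_of_pos (by exact decide_eq_true hj), isSchedule_dropoff]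
        refine ⟨mem_inter.2 ⟨h'.1, hj⟩, h'.2.1, ?_⟩
        rwa [erase_inter] at h2
      · rw [List.filter_cons_of_neg (by exact fun h => hj (of_decide_eq_true h))]
        rw [erase_inter, erase_eq_of_notMem (by simp [hj])] at h2
        exact h2.of_move h'.2.1

end IsSchedule

/-- The plan `S` with all times shifted by `δ`. -/
def shift (δ : ℝ) (S : Plan σ) : Plan σ := S.map fun a => (a.1 + δ, a.2)

theorem endTime_shift (δ : ℝ) (S : Plan σ) : endTime (t + δ) (shift δ S) = endTime t S + δ := by
  induction S generalizing t with
  | nil => rfl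
  | cons a S ih => exact ih

/-- A delay never violates a release time; an advance is harmless when everything to be picked up
has already appeared at the new start. -/
theorem IsSchedule.shift (h : IsSchedule c σ t p W B S) {δ : ℝ}
    (hδ : 0 ≤ δ ∨ ∀ i ∈ W, (σ.req i).rel ≤ t + δ) :
    IsSchedule c σ (t + δ) p W B (shift δ S) := by
  induction S generalizing t p W B with
  | nil => rw [isSchedule_nil] at h; simp [DialARide.shift, isSchedule_nil, h.1, h.2]
  | cons a S ih =>
    obtain ⟨s, j⟩ := a
    have hs : t ≤ s := by
      have := h.head_le
      have := abs_nonneg (j.pos σ - p)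
      linarith
    obtain j | j := j
    · have h' := isSchedule_pickup.1 h
      have hr : (σ.req j).rel ≤ s + δ := by
        rcases hδ with hδ | hδ
        · linarith [h'.2.2.2.1]
        · linarith [hδ j h'.1]
      have hδ' : 0 ≤ δ ∨ ∀ i ∈ W.erase j, (σ.req i).rel ≤ s + δ :=
        hδ.imp_right fun hδ i hi => by linarith [hδ i (mem_of_mem_erase hi)]
      exact isSchedule_pickup.2 ⟨h'.1, h'.2.1, by linarith [h'.2.2.1], hr, ih h'.2.2.2.2 hδ'⟩
    · have h' := isSchedule_dropoff.1 h
      have hδ' : 0 ≤ δ ∨ ∀ i ∈ W, (σ.req i).rel ≤ s + δ :=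
        hδ.imp_right fun hδ i hi => by linarith [hδ i hi]
      exact isSchedule_dropoff.2 ⟨h'.1, by linarith [h'.2.1], ih h'.2.2 hδ'⟩

/-- The count can fail only when a request is both waiting and on board. Its purpose is that only
finitely many stop orders have to be compared for an optimal schedule. -/
theorem IsSchedule.length (h : IsSchedule c σ t p W B S) :
    S.length = 2 * W.card + B.card ∨ ∃ i ∈ W, i ∈ B := by
  by_contra! hcon
  obtain ⟨hl, hd⟩ := hcon
  apply hl
  clear hl
  induction S generalizing t p W B with
  | nil => rw [isSchedule_nil] at h; simp [h.1, h.2]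
  | cons a S ih =>
    obtain ⟨s, j | j⟩ := a
    · have h' := isSchedule_pickup.1 h
      have hj := h'.1
      have := ih h'.2.2.2.2 (fun i hi => by
        have := mem_erase.1 hi
        simp [this.1, hd i this.2])
      rw [card_erase_of_mem hj, card_insert_of_notMem (hd j hj)] at this
      have := card_pos.2 ⟨j, hj⟩
      simp only [List.length_cons]; omega
    · have h' := isSchedule_dropoff.1 h
      have := ih h'.2.2 (fun i hi hi' => hd i hi (mem_of_mem_erase hi'))
      rw [card_erase_of_mem h'.1] at this
      have := card_pos.2 ⟨j, h'.1⟩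
      simp only [List.length_cons]; omega

/-- The plan that executes the given stops in the given order as early as possible. -/
noncomputable def eager (σ : Input) : ℝ → ℝ → List (Stop (Fin σ.n)) → Plan σ
  | _, _, [] => []
  | t, p, .pickup i :: l =>
      (max (t + |(σ.req i).src - p|) (σ.req i).rel, .pickup i) ::
        eager σ (max (t + |(σ.req i).src - p|) (σ.req i).rel) (σ.req i).src l
  | t, p, .dropoff i :: l =>
      (t + |(σ.req i).dst - p|, .dropoff i) :: eager σ (t + |(σ.req i).dst - p|) (σ.req i).dst l

/-- For a fixed order of stops, reaching each stop earlier never hurts later ones. -/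
theorem IsSchedule.eager (h : IsSchedule c σ t p W B S) (ht : t' ≤ t) :
    IsSchedule c σ t' p W B (eager σ t' p (S.map Prod.snd)) ∧
      endTime t' (DialARide.eager σ t' p (S.map Prod.snd)) ≤ endTime t S := by
  induction S generalizing t t' p W B with
  | nil => exact ⟨by rw [isSchedule_nil] at h; simpa [DialARide.eager, isSchedule_nil] using h, ht⟩
  | cons a S ih =>
    obtain ⟨s, j | j⟩ := a
    · have h' := isSchedule_pickup.1 h
      obtain ⟨h1, h2⟩ := ih h'.2.2.2.2 (max_le (by linarith [h'.2.2.1]) h'.2.2.2.1 :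
        max (t' + |(σ.req j).src - p|) (σ.req j).rel ≤ s)
      exact ⟨isSchedule_pickup.2 ⟨h'.1, h'.2.1, le_max_left _ _, le_max_right _ _, h1⟩, h2⟩
    · have h' := isSchedule_dropoff.1 h
      obtain ⟨h1, h2⟩ := ih h'.2.2 (by linarith [h'.2.1] : t' + |(σ.req j).dst - p| ≤ s)
      exact ⟨isSchedule_dropoff.2 ⟨h'.1, le_rfl, h1⟩, h2⟩

instance {ι : Type} [Finite ι] : Finite (Stop ι) :=
  Finite.of_surjective (Sum.elim Stop.pickup Stop.dropoff : ι ⊕ ι → Stop ι) fun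
    | .pickup i => ⟨.inl i, rfl⟩
    | .dropoff i => ⟨.inr i, rfl⟩

/-- From position `p` at time `t`, the requests in `W` can be served until time `e`. -/
def Serves (c : ℕ∞) (σ : Input) (t p : ℝ) (W : Finset (Fin σ.n)) (e : ℝ) : Prop :=
  ∃ S, IsSchedule c σ t p W ∅ S ∧ endTime t S ≤ e

theorem serves_empty {e : ℝ} (h : t ≤ e) : Serves c σ t p ∅ e :=
  ⟨[], isSchedule_nil.2 ⟨rfl, rfl⟩, h⟩

/-- Requests can be served one at a time. -/
theorem Serves.step (hc : 1 ≤ c) {i : Fin σ.n} (hi : i ∈ W) {u e : ℝ}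
    (hu : t + |(σ.req i).src - p| ≤ u) (hr : (σ.req i).rel ≤ u)
    (h : Serves c σ (u + |(σ.req i).dst - (σ.req i).src|) (σ.req i).dst (W.erase i) e) :
    Serves c σ t p W e := by
  obtain ⟨S, hS, he⟩ := h
  refine ⟨(u, .pickup i) :: (u + |(σ.req i).dst - (σ.req i).src|, .dropoff i) :: S,
    isSchedule_pickup.2 ⟨hi, by simpa using hc, hu, hr, isSchedule_dropoff.2 ⟨by simp, le_rfl, ?_⟩⟩,
    he⟩
  simpa using hS

theorem exists_isSchedule (hc : 1 ≤ c) (t p : ℝ) (W : Finset (Fin σ.n)) :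
    ∃ S, IsSchedule c σ t p W ∅ S := by
  suffices ∃ e, Serves c σ t p W e by
    obtain ⟨_, S, hS, _⟩ := this
    exact ⟨S, hS⟩
  induction W using Finset.induction generalizing t p with
  | empty => exact ⟨t, serves_empty le_rfl⟩
  | insert i W hi ih =>
    obtain ⟨e, he⟩ := ih (max (t + |(σ.req i).src - p|) (σ.req i).rel +
      |(σ.req i).dst - (σ.req i).src|) (σ.req i).dst
    refine ⟨e, .step hc (mem_insert_self i W) (le_max_left _ _) (le_max_right _ _) ?_⟩
    rwa [erase_insert hi]

end DialARide

/-! ### Optimal schedules and well-definedness of Smartstart -/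

namespace DialARide

open Finset Filter Topology

variable {c : ℕ∞} {σ : Input} {t t' p q s : ℝ} {W B P R : Finset (Fin σ.n)} {S : Plan σ}

theorem bddBelow_lengths (c : ℕ∞) (σ : Input) (t p : ℝ) (R : Finset (Fin σ.n)) :
    BddBelow {ℓ | ∃ S : Plan σ, IsSchedule c σ t p R ∅ S ∧ ℓ = endTime t S - t} := by
  refine ⟨0, ?_⟩
  rintro _ ⟨S, hS, rfl⟩
  exact sub_nonneg.2 hS.le_endTime

theorem IsSchedule.L_le (h : IsSchedule c σ t p R ∅ S) : L c σ t p R ≤ endTime t S - t :=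
  csInf_le (bddBelow_lengths c σ t p R) ⟨S, h, rfl⟩

theorem Serves.L_le {e : ℝ} (h : Serves c σ t p R e) : L c σ t p R ≤ e - t := by
  obtain ⟨S, hS, he⟩ := h
  linarith [hS.L_le]

/-- Optimal schedules exist. -/
theorem exists_optimal (hc : 1 ≤ c) (t p : ℝ) (R : Finset (Fin σ.n)) :
    ∃ S, IsSchedule c σ t p R ∅ S ∧ endTime t S - t = L c σ t p R := by
  let G : Set (List (Stop (Fin σ.n))) :=
    {l | l.length = 2 * R.card ∧ IsSchedule c σ t p R ∅ (eager σ t p l)}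
  have hlen {S : Plan σ} (hS : IsSchedule c σ t p R ∅ S) : S.length = 2 * R.card := by
    simpa using hS.length
  have hG {S : Plan σ} (hS : IsSchedule c σ t p R ∅ S) : S.map Prod.snd ∈ G :=
    ⟨by simpa using hlen hS, (hS.eager le_rfl).1⟩
  have hfin : G.Finite := (List.finite_length_eq _ (2 * R.card)).subset fun l hl => hl.1
  obtain ⟨S₀, hS₀⟩ := exists_isSchedule hc t p R
  obtain ⟨l, hl, hmin⟩ := Set.exists_min_image G (fun l => endTime t (eager σ t p l)) hfin
    ⟨_, hG hS₀⟩
  refine ⟨_, hl.2, le_antisymm ?_ hl.2.L_le⟩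
  refine le_csInf ⟨_, S₀, hS₀, rfl⟩ ?_
  rintro _ ⟨S, hS, rfl⟩
  have h1 := hmin _ (hG hS)
  have h2 := (hS.eager le_rfl).2
  linarith

theorem L_nonneg (c : ℕ∞) (σ : Input) (t p : ℝ) (R : Finset (Fin σ.n)) : 0 ≤ L c σ t p R :=
  Real.sInf_nonneg (by rintro _ ⟨S, hS, rfl⟩; exact sub_nonneg.2 hS.le_endTime)

theorem L_antitone (hc : 1 ≤ c) (h : t ≤ t') : L c σ t' p R ≤ L c σ t p R := by
  obtain ⟨S, hS, he⟩ := exists_optimal hc t p R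
  have h1 := (hS.shift (δ := t' - t) (.inl (by linarith))).L_le
  rw [endTime_shift] at h1
  rw [add_sub_cancel] at h1
  linarith

theorem endTime_mono (h : t ≤ t') (S : Plan σ) : endTime t S ≤ endTime t' S := by
  cases S with
  | nil => exact h
  | cons a S => exact le_rfl

/-- The server can wait at `p` until `t'`. Together with `L_antitone`, this makes `L` 1-Lipschitz in
time. -/
theorem L_le_add_sub (hc : 1 ≤ c) (h : t ≤ t') : L c σ t p R ≤ L c σ t' p R + (t' - t) := by
  obtain ⟨S, hS, he⟩ := exists_optimal hc t' p R
  have h1 := (hS.of_move (p := p) (t := t) (by simpa using h)).L_le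
  linarith [endTime_mono h S]

theorem endTime_eq_of_ne_nil (h : S ≠ []) : endTime t S = endTime t' S := by
  cases S with
  | nil => exact absurd rfl h
  | cons a S => rfl

/-- The stops of a schedule that concern the requests in `P`, all of which have appeared, can be
executed in the same way from an arbitrary position. -/
theorem IsSchedule.exists_follow (h : IsSchedule c σ 0 0 univ ∅ S) (hP : P.Nonempty)
    (hr : ∀ i ∈ P, (σ.req i).rel ≤ s) :
    ∃ j ∈ P, ∃ d ∈ P, ∃ τ v, (τ, .pickup j) ∈ S ∧ (v, .dropoff d) ∈ S ∧ (σ.req j).rel ≤ τ ∧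
      ∀ p, L c σ s p P ≤ |(σ.req j).src - p| + (v - τ) := by
  have hF := h.restrict P
  rw [univ_inter, empty_inter] at hF
  have hsub : S.filter (fun a => decide (a.2.idx ∈ P)) ⊆ S := List.filter_subset_self _
  obtain ⟨d, hd, hdm, -⟩ := hF.exists_last (by simpa using hP)
  rw [union_empty] at hd
  generalize S.filter (fun a => decide (a.2.idx ∈ P)) = F at hF hsub hdm
  rcases F with _ | ⟨⟨τ, j | j⟩, F⟩
  · rw [isSchedule_nil] at hF
    exact absurd hF.1 hP.ne_empty
  · have h' := isSchedule_pickup.1 hF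
    refine ⟨j, h'.1, d, hd, τ, _, hsub List.mem_cons_self, hsub hdm, h'.2.2.2.1, fun p => ?_⟩
    -- The start is timed so that the first pickup is reached exactly at `τ`; the whole plan is then
    -- moved to start at `s`, possibly backwards in time.
    have h1 := hF.change_start (t' := τ - |(σ.req j).src - p|) (q := p)
      (by simp [Stop.pos])
    have h2 := (h1.shift (δ := s - (τ - |(σ.req j).src - p|)) (.inr (by simpa using hr))).L_le
    rw [endTime_shift, add_sub_cancel] at h2
    rw [endTime_eq_of_ne_nil (t' := 0) (by simp)] at h2
    linarith
  · simp [isSchedule_dropoff] at hF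

theorem mem_pending {U : Finset (Fin σ.n)} {i : Fin σ.n} :
    i ∈ pending σ U t ↔ i ∈ U ∧ (σ.req i).rel ≤ t := by
  simp [pending]

/-- The times at which Smartstart, idle at position `p` since time `t`, may start. -/
def startTimes (c : ℕ∞) (Θ : ℝ) (σ : Input) (t p : ℝ) (U : Finset (Fin σ.n)) : Set ℝ :=
  {s | t ≤ s ∧ (pending σ U s).Nonempty ∧ L c σ s p (pending σ U s) / (Θ - 1) ≤ s}

theorem eventually_pending_eq (σ : Input) (U : Finset (Fin σ.n)) (s : ℝ) :
    ∀ᶠ s' in 𝓝[≥] s, pending σ U s' = pending σ U s := by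
  have h : ∀ i : Fin σ.n, ∀ᶠ s' in 𝓝[≥] s, ((σ.req i).rel ≤ s' ↔ (σ.req i).rel ≤ s) := by
    intro i
    rcases le_or_gt (σ.req i).rel s with hi | hi
    · filter_upwards [self_mem_nhdsWithin] with s' hs'
      exact ⟨fun _ => hi, fun _ => hi.trans hs'⟩
    · filter_upwards [mem_nhdsWithin_of_mem_nhds (Iio_mem_nhds hi)] with s' hs'
      exact ⟨fun h => absurd h (not_le.2 hs'), fun h => absurd h (not_le.2 hi)⟩
  filter_upwards [eventually_all.2 h] with s' hs'
  simp [pending, hs']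

/-- The waiting time of Smartstart exists. -/
theorem exists_isLeast_startTimes (hc : 1 ≤ c) {Θ : ℝ} (hΘ : 1 < Θ) (t p : ℝ)
    {U : Finset (Fin σ.n)} (hU : U.Nonempty) : ∃ s, IsLeast (startTimes c Θ σ t p U) s := by
  have hΘ' : 0 < Θ - 1 := sub_pos.2 hΘ
  have hne : (startTimes c Θ σ t p U).Nonempty := by
    obtain ⟨M, hM⟩ := (Finset.finite_toSet (univ.image fun i => (σ.req i).rel)).bddAbove
    have hM' (i : Fin σ.n) : (σ.req i).rel ≤ M := hM (by simp)
    set N := max t M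
    have hp (s : ℝ) (hs : N ≤ s) : pending σ U s = U := by
      ext i
      simp only [mem_pending, and_iff_left_iff_imp]
      exact fun _ => (hM' i).trans ((le_max_right t M).trans hs)
    refine ⟨max N (L c σ N p U / (Θ - 1)), (le_max_left t M).trans (le_max_left _ _), ?_⟩
    rw [hp _ (le_max_left _ _)]
    refine ⟨hU, le_trans ?_ (le_max_right _ _)⟩
    exact div_le_div_of_nonneg_right (L_antitone hc (le_max_left _ _)) hΘ'.le
  have hbdd : BddBelow (startTimes c Θ σ t p U) := ⟨t, fun s hs => hs.1⟩
  refine ⟨sInf (startTimes c Θ σ t p U), ?_, fun s hs => csInf_le hbdd hs⟩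
  set m := sInf (startTimes c Θ σ t p U)
  -- The pending set is constant just to the right of the infimum `m`, so admissible times close to
  -- `m` see the same requests as `m` itself.
  obtain ⟨u, hu, hpu⟩ := mem_nhdsGE_iff_exists_Ico_subset.1 (eventually_pending_eq σ U m)
  have key (ε : ℝ) (hε : 0 < ε) : ∃ a ∈ startTimes c Θ σ t p U, m ≤ a ∧ a < m + ε ∧
      pending σ U a = pending σ U m := by
    obtain ⟨a, ha, hlt⟩ := exists_lt_of_csInf_lt hne
      (lt_min (lt_add_of_pos_right m hε) hu : m < min (m + ε) u)
    have hma : m ≤ a := csInf_le hbdd ha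
    exact ⟨a, ha, hma, hlt.trans_le (min_le_left _ _),
      hpu ⟨hma, hlt.trans_le (min_le_right _ _)⟩⟩
  refine ⟨le_csInf hne fun s hs => hs.1, ?_, ?_⟩
  · obtain ⟨a, ha, -, -, he⟩ := key 1 one_pos
    exact he ▸ ha.2.1
  · rw [div_le_iff₀ hΘ']
    refine le_of_forall_pos_le_add fun ε hε => ?_
    -- Moving from `a` back to `m` raises `L` by at most `a - m` and lowers the threshold by `(Θ -
    -- 1) * (a - m)`, a total loss of `Θ * (a - m) < ε`.
    obtain ⟨a, ha, hma, hlt, he⟩ := key (ε / Θ) (by positivity)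
    have h1 := ha.2.2
    rw [he, div_le_iff₀ hΘ'] at h1
    have h2 := L_le_add_sub (σ := σ) (p := p) (R := pending σ U m) hc hma
    have h3 : (a - m) * Θ < ε := by rw [← lt_div_iff₀ (by linarith)]; linarith
    nlinarith

theorem exists_smartstartRun (hc : 1 ≤ c) {Θ : ℝ} (hΘ : 1 < Θ) (t p : ℝ)
    (U : Finset (Fin σ.n)) : ∃ T, SmartstartRun c Θ σ t p U T := by
  induction U using Finset.strongInduction generalizing t p with
  | H U ih =>
    rcases U.eq_empty_or_nonempty with rfl | hU
    · exact ⟨t, .done t p⟩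
    · obtain ⟨s, hs⟩ := exists_isLeast_startTimes hc hΘ t p hU
      obtain ⟨S, hS, he⟩ := exists_optimal hc s p (pending σ U s)
      have hlt : U \ pending σ U s ⊂ U :=
        sdiff_ssubset (filter_subset _ _) hs.1.2.1
      obtain ⟨T, hT⟩ := ih _ hlt (endTime s S) (endPos p S)
      exact ⟨T, .step t p U s S T hs hS he hT⟩

/-- Smartstart is well defined. -/
theorem exists_isSmartstart (hc : 1 ≤ c) {Θ : ℝ} (hΘ : 1 < Θ) : ∃ A, IsSmartstart c Θ A :=
  ⟨fun _ => (exists_smartstartRun hc hΘ 0 0 univ).choose,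
    fun _ => (exists_smartstartRun hc hΘ 0 0 univ).choose_spec⟩

end DialARide

/-! ### The upper bound -/

namespace DialARide

open Finset Filter Topology

variable {c : ℕ∞} {σ : Input} {Θ t p s : ℝ} {P U : Finset (Fin σ.n)} {S : Plan σ}

/-- If the requests in `P` have all appeared, and none appeared before the server could have
been at distance `|p|` from the origin at speed `Θ`, then the cost of serving them from `p` is
bounded in terms of the offline optimum. -/
theorem L_le_opt (hc : 1 ≤ c) (hΘ : 0 ≤ Θ) (hp : p = 0 ∨ ∃ i, p = (σ.req i).dst)
    (hP : P.Nonempty) (hr : ∀ i ∈ P, (σ.req i).rel ≤ s) (hb : ∀ i ∈ P, |p| ≤ Θ * (σ.req i).rel) :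
    (Θ + 2) * L c σ s p P ≤ (2 * Θ + 2) * opt c σ := by
  obtain ⟨S, hS, hE⟩ := exists_optimal (σ := σ) hc 0 0 univ
  change endTime 0 S - 0 = opt c σ at hE
  generalize opt c σ = E at hE ⊢
  obtain ⟨j, hj, d, hd, τ, v, hτ, hv, hjτ, hL⟩ := hS.exists_follow hP hr
  have hL := hL p
  have h1 := hS.le_of_mem hτ
  have h2 := hS.endTime_ge_of_mem hτ
  have h3 := hS.endTime_ge_of_mem hv
  have h4 := abs_nonneg (endPos 0 S - (Stop.dropoff d).pos σ)
  have h5 := abs_nonneg (endPos 0 S - (Stop.pickup j).pos σ)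
  have h6 := abs_nonneg ((Stop.pickup j).pos σ - 0)
  rw [sub_zero] at h1 h6
  simp only [Stop.pos] at h1 h6
  rcases hp with rfl | ⟨i, hi⟩
  · rw [sub_zero] at hL
    nlinarith
  · obtain ⟨u, w, -, hw, -, -⟩ := hS.exists_stops (mem_univ i)
    have h7 := hS.dist_le_of_mem hτ hw
    have h8 := hS.endTime_ge_of_mem hw
    have h9 := abs_nonneg (endPos 0 S - (Stop.dropoff i).pos σ)
    have h10 := hS.le_of_mem hw
    have h11 := abs_nonneg ((Stop.dropoff i).pos σ - 0)
    simp only [Stop.pos] at h7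
    rw [← hi] at h7
    -- If the optimum visits `p` before its first pickup from `P`, imitation costs at most `E`, as
    -- it does for `p = 0`.
    rcases le_total w τ with hwτ | hwτ
    · rw [abs_of_nonneg (sub_nonneg.2 hwτ)] at h7
      nlinarith
    · rw [abs_of_nonpos (sub_nonpos.2 hwτ)] at h7
      have h12 := abs_sub (σ.req j).src p
      have h13 := mul_le_mul_of_nonneg_left hjτ hΘ
      have h14 := hb j hj
      -- Otherwise `L ≤ E + Θ * τ` and `L ≤ 2 * (E - τ)`; adding them with weights `2` and `Θ`
      -- cancels `τ`.
      have h15 : |(σ.req j).src - p| ≤ (1 + Θ) * τ := by linarith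
      have h16 : |(σ.req j).src - p| ≤ E - τ := by linarith
      nlinarith

/-- The cost bound for two schedules of Smartstart of which the second one is started
immediately after the first one. -/
theorem add_L_le_of_no_wait (hc : 1 ≤ c) (hΘ : 2 ≤ Θ) (hP : P.Nonempty)
    (hr : ∀ i ∈ P, (σ.req i).rel ≤ s) (hb : ∀ i ∈ P, |p| ≤ Θ * (σ.req i).rel)
    (hS : IsSchedule c σ s p P ∅ S) (hopt : endTime s S - s = L c σ s p P)
    (hs : L c σ s p P ≤ (Θ - 1) * s) (hU : U.Nonempty) (hrU : ∀ i ∈ U, s < (σ.req i).rel)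
    (hrU' : ∀ i ∈ U, (σ.req i).rel ≤ endTime s S) :
    endTime s S + L c σ (endTime s S) (endPos p S) U ≤ f₂ Θ * opt c σ := by
  obtain ⟨O, hO, hE⟩ := exists_optimal (σ := σ) hc 0 0 univ
  change endTime 0 O - 0 = opt c σ at hE
  rw [sub_zero] at hE
  have hmem {v : ℝ} {e : Stop (Fin σ.n)} (h : (v, e) ∈ O) : |e.pos σ| ≤ v ∧ v ≤ opt c σ := by
    have h1 := hO.le_of_mem h
    have h2 := hO.endTime_ge_of_mem h
    have h3 := abs_nonneg (endPos 0 O - e.pos σ)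
    rw [sub_zero] at h1
    exact ⟨by linarith, by linarith⟩
  generalize opt c σ = E at hE hmem ⊢
  -- `i` is delivered last by Smartstart, at `y`, and at time `v` by the optimum. In the optimum,
  -- `j` is the first pickup from `U`, `j₂` the first pickup from `P`, and `d` the last delivery
  -- from `P`.
  obtain ⟨i, hi, -, hy⟩ := hS.exists_last (by simpa using hP)
  rw [union_empty] at hi
  obtain ⟨u, v, -, hv, hiu, huv⟩ := hO.exists_stops (mem_univ i)
  obtain ⟨j, hj, d', hd', τ, w, hτ, hw, hjτ, hL⟩ := hO.exists_follow hU hrU'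
  obtain ⟨j₂, hj₂, d, hd, τ₂, v', hτ₂, hv', -, hL₂⟩ := hO.exists_follow hP hr
  obtain ⟨-, w', -, hw', -, -⟩ := hS.exists_stops hd
  have a1 := hS.le_of_mem hw'
  have a2 := hS.endTime_ge_of_mem hw'
  have a3 := hL (endPos p S)
  have a4 := hL₂ p
  have a5 := hO.dist_le_of_mem hτ hv
  have a6 := hO.dist_le_of_mem hτ hv'
  have a7 := hmem hτ
  have a8 := hmem hw
  have a9 := hmem hτ₂
  have a10 := hmem hv'
  have a11 := hmem hv
  have a12 := hrU j hj
  have a13 : |p| ≤ Θ * v := by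
    refine (hb i hi).trans (mul_le_mul_of_nonneg_left ?_ (by linarith))
    linarith [abs_nonneg ((σ.req i).dst - (σ.req i).src)]
  rw [hy] at a2 a3
  rw [hy]
  simp only [Stop.pos] at a1 a2 a5 a6 a7 a8 a9 a10 a11
  generalize (σ.req i).dst = y at *
  generalize (σ.req j).src = a at *
  generalize (σ.req d).dst = x at *
  generalize (σ.req j₂).src = b at *
  set T := endTime s S + L c σ (endTime s S) y U
  set ℓ := L c σ s p P
  have hs0 : s < E := by linarith
  have hv0 : 0 ≤ v := (abs_nonneg y).trans a11.1
  have key : (3 * Θ + 3) * T ≤ ((3 * Θ + 3) * (Θ + 1) - (Θ - 1)) * E := by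
    -- If the optimum picks up `j` before delivering `i`, then both driving to `j` and imitating
    -- take at most `E - τ`, and even `Θ * E` suffices.
    rcases le_total τ v with hτv | hτv
    · rw [abs_of_nonpos (sub_nonpos.2 hτv)] at a5
      have hT : T ≤ Θ * s + 2 * (E - s) := by linarith
      have hT' : T ≤ Θ * E := by nlinarith
      nlinarith
    · rw [abs_of_nonneg (sub_nonneg.2 hτv)] at a5
      have b1 : ℓ ≤ |p| + v' := by
        have := abs_sub b p
        linarith
      -- Smartstart visits `x` before it ends at `y`, so a large `|y - x|` makes `ℓ` large; `b3`
      -- bounds how late the optimum can finish `P` in terms of `|y - x|`. Eliminating `|y - x|` and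
      -- `v'` gives `b5`.
      have b2 : 2 * |y - x| - |p| - v ≤ ℓ := by
        have := abs_sub_le y p x
        have := abs_sub y p
        have := abs_sub_comm p x
        linarith
      have b3 : v' - v ≤ |y - x| + (τ - v - |a - y|) + 2 * (E - τ) := by
        rcases le_total v' τ with h | h
        · rw [abs_of_nonneg (sub_nonneg.2 h)] at a6
          have := abs_sub_le a x y
          have := abs_sub_comm x y
          linarith
        · rw [abs_of_nonpos (sub_nonpos.2 h)] at a6
          have := abs_sub_le a x y
          have := abs_sub_comm x y
          linarith
      have b4 : T ≤ s + ℓ + |a - y| + E - τ := by linarith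
      have b5 : ℓ ≤ 3 * (Θ * v + v) + 2 * (τ - v - |a - y|) + 4 * (E - τ) := by linarith
      -- `c1` uses the waiting condition `ℓ ≤ (Θ - 1) * s`, `c2` uses `b5`. With weights `3 * Θ + 2`
      -- and `1` the terms in `v` cancel, and the slacks `τ - v - |a - y|` and `E - τ` get
      -- coefficients of the favourable sign.
      have c1 : T ≤ (Θ + 1) * E - v - (τ - v - |a - y|) - Θ * (E - τ) := by
        have := mul_le_mul_of_nonneg_left (by linarith : s ≤ τ) (by linarith : 0 ≤ Θ)
        linarith
      have c2 : T ≤ 2 * E - v + (τ - v - |a - y|) + 3 * (E - τ) + 3 * (Θ + 1) * v := by linarith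
      have e1 : 0 ≤ τ - v - |a - y| := by linarith
      have e2 : 0 ≤ E - τ := by linarith
      generalize τ - v - |a - y| = e at *
      generalize E - τ = η at *
      linarith [mul_le_mul_of_nonneg_left c1 (by linarith : (0 : ℝ) ≤ 3 * Θ + 2),
        mul_nonneg (by linarith : (0 : ℝ) ≤ 3 * Θ + 1) e1,
        mul_nonneg (by nlinarith : (0 : ℝ) ≤ (3 * Θ + 2) * Θ - 3) e2]
  have hf : f₂ Θ = ((3 * Θ + 3) * (Θ + 1) - (Θ - 1)) / (3 * Θ + 3) := by
    unfold f₂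
    field_simp
  rw [hf, div_mul_eq_mul_div, le_div_iff₀ (by linarith)]
  linarith

/-- Smartstart starts immediately, when a request appears, or when the waiting condition becomes
an equality. -/
theorem start_cases (hc : 1 ≤ c) (hΘ : 1 < Θ) (h : IsLeast (startTimes c Θ σ t p U) s) :
    s = t ∨ (∃ i ∈ U, (σ.req i).rel = s) ∨ L c σ s p (pending σ U s) = (Θ - 1) * s := by
  by_contra! hcon
  obtain ⟨h1, h2, h3⟩ := hcon
  have hΘ' : 0 < Θ - 1 := sub_pos.2 hΘ
  obtain ⟨⟨hts, hne, hle⟩, hmin⟩ := h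
  rw [div_le_iff₀ hΘ', mul_comm] at hle
  have hlt := lt_of_le_of_ne hle h3
  have e1 : ∀ᶠ s' in 𝓝[<] s, t < s' :=
    mem_nhdsWithin_of_mem_nhds (Ioi_mem_nhds (lt_of_le_of_ne hts h1.symm))
  have e2 : ∀ᶠ s' in 𝓝[<] s, ∀ i ∈ U, ((σ.req i).rel ≤ s' ↔ (σ.req i).rel ≤ s) := by
    rw [Finset.eventually_all]
    intro i hi
    rcases lt_or_gt_of_ne (h2 i hi) with hi | hi
    · filter_upwards [mem_nhdsWithin_of_mem_nhds (Ioi_mem_nhds hi)] with s' hs'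
      exact ⟨fun _ => hi.le, fun _ => le_of_lt hs'⟩
    · filter_upwards [self_mem_nhdsWithin] with s' hs'
      exact ⟨fun h => absurd (h.trans (le_of_lt hs')) (not_le.2 hi),
        fun h => absurd h (not_le.2 hi)⟩
  -- If the inequality is strict, it survives a slightly earlier start, since `L` grows by at most
  -- `s - s'`.
  have e3 : ∀ᶠ s' in 𝓝[<] s, L c σ s p (pending σ U s) < (Θ - 1) * s' - (s - s') := by
    refine mem_nhdsWithin_of_mem_nhds ?_
    have hcont : Continuous fun s' => (Θ - 1) * s' - (s - s') := by fun_prop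
    exact hcont.continuousAt.eventually (lt_mem_nhds (by simpa using hlt))
  obtain ⟨s', h4, h5, h6, h7⟩ := (e1.and (e2.and (e3.and self_mem_nhdsWithin))).exists
  have h7 : s' < s := h7
  have hpe : pending σ U s' = pending σ U s := by
    ext i
    simp only [mem_pending, and_congr_right_iff]
    exact h5 i
  refine absurd (hmin ⟨h4.le, hpe ▸ hne, ?_⟩) (not_le.2 h7)
  rw [hpe, div_le_iff₀ hΘ', mul_comm]
  linarith [L_le_add_sub (σ := σ) (p := p) (R := pending σ U s) hc h7.le]

/-- What is known about Smartstart when it is idle at position `p` at time `t` and the requests in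
`U` are not yet served. -/
structure IdleBound (c : ℕ∞) (Θ ρ : ℝ) (σ : Input) (t p : ℝ) (U : Finset (Fin σ.n)) : Prop where
  pos_le : |p| ≤ t
  pos_le_rel : ∀ i ∈ U, |p| ≤ Θ * (σ.req i).rel
  pos_eq : p = 0 ∨ ∃ i, p = (σ.req i).dst
  finished : U = ∅ → t ≤ ρ * opt c σ
  started : U.Nonempty → (∀ i ∈ U, (σ.req i).rel ≤ t) → t + L c σ t p U ≤ ρ * opt c σ

theorem rel_le_opt (hc : 1 ≤ c) (i : Fin σ.n) : (σ.req i).rel ≤ opt c σ := by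
  obtain ⟨O, hO, hE⟩ := exists_optimal (σ := σ) hc 0 0 univ
  obtain ⟨u, v, -, hv, hiu, huv⟩ := hO.exists_stops (mem_univ i)
  have h1 := hO.endTime_ge_of_mem hv
  have h2 := abs_nonneg (endPos 0 O - (Stop.dropoff i).pos σ)
  have h3 := abs_nonneg ((σ.req i).dst - (σ.req i).src)
  change _ = opt c σ at hE
  linarith

/-- `IdleBound` is the invariant carried along the run. Its field `started` prepays a last schedule
that begins without waiting, so the two-schedule estimate is made at the end of the earlier
schedule. -/
theorem SmartstartRun.le_mul_opt (hc : 1 ≤ c) (hΘ : 2 ≤ Θ) {ρ T : ℝ}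
    (h₁ : f₁ Θ ≤ ρ) (h₂ : f₂ Θ ≤ ρ) (h : SmartstartRun c Θ σ t p U T)
    (hb : IdleBound c Θ ρ σ t p U) : T ≤ ρ * opt c σ := by
  have hopt0 : 0 ≤ opt c σ := L_nonneg c σ 0 0 univ
  have hΘ1 : 0 < Θ - 1 := by linarith
  induction h with
  | done t p => exact hb.finished rfl
  | step t p U s S T start sched optimal rest ih =>
    have hts := start.1.1
    have hne := start.1.2.1
    have hle := start.1.2.2
    rw [div_le_iff₀ hΘ1, mul_comm] at hle
    have hend := sched.dist_endPos_le
    have hpos : |endPos p S| ≤ endTime s S := by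
      have := abs_sub_abs_le_abs_sub (endPos p S) p
      linarith [hb.pos_le]
    have hrel : ∀ i ∈ U \ pending σ U s, s < (σ.req i).rel := by
      intro i hi
      rw [Finset.mem_sdiff, mem_pending] at hi
      by_contra! hcon
      exact hi.2 ⟨hi.1, hcon⟩
    have hPr : ∀ i ∈ pending σ U s, (σ.req i).rel ≤ s := fun i hi => (mem_pending.1 hi).2
    have hPb : ∀ i ∈ pending σ U s, |p| ≤ Θ * (σ.req i).rel :=
      fun i hi => hb.pos_le_rel i (mem_pending.1 hi).1
    refine ih ⟨hpos, fun i hi => ?_, ?_, fun hU => ?_, fun hU hr => ?_⟩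
    · have := mul_le_mul_of_nonneg_left (hrel i hi).le (by linarith : 0 ≤ Θ)
      linarith
    · obtain ⟨i, -, -, hi⟩ := sched.exists_last (by simpa using hne)
      exact .inr ⟨i, hi⟩
    · have hPU : pending σ U s = U :=
        (filter_subset _ _).antisymm (sdiff_eq_empty_iff_subset.1 hU)
      have hG := L_le_opt hc (by linarith) hb.pos_eq hne hPr hPb
      have hE : endTime s S = s + L c σ s p U := by
        rw [hPU] at optimal
        linarith
      rcases start_cases hc (by linarith) start with rfl | ⟨i, -, hi⟩ | hw
      · rw [hE]
        rw [hPU] at hne hPr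
        exact hb.started hne hPr
      · have h3 := rel_le_opt (σ := σ) hc i
        rw [hPU] at hG
        -- Here `s` is a release time, hence at most the optimum; adding the bound on `L` gives the
        -- ratio `1 + (2Θ+2)/(Θ+2)`.
        have h4 : (3 * Θ + 4) / (Θ + 2) ≤ ρ := by
          refine le_trans ?_ h₂
          unfold f₂
          rw [div_le_iff₀ (by linarith), sub_mul, div_mul_eq_mul_div, le_sub_iff_add_le,
            ← le_sub_iff_add_le', div_le_iff₀ (by linarith)]
          nlinarith [mul_nonneg (sq_nonneg Θ) (sub_nonneg.2 hΘ)]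
        refine le_trans ?_ (mul_le_mul_of_nonneg_right h4 hopt0)
        rw [div_mul_eq_mul_div, le_div_iff₀ (by linarith)]
        nlinarith
      · rw [hPU] at hG hw
        -- The waiting condition is tight, so the end time is `Θ * s` with `(Θ - 1) * s = L`.
        refine le_trans ?_ (mul_le_mul_of_nonneg_right h₁ hopt0)
        unfold f₁
        rw [div_mul_eq_mul_div, le_div_iff₀ (by nlinarith), hE, hw]
        rw [hw] at hG
        have := mul_le_mul_of_nonneg_left hG (by linarith : 0 ≤ Θ)
        linarith
    · exact (add_L_le_of_no_wait hc hΘ hne hPr hPb sched optimal hle hU hrel hr).trans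
        (mul_le_mul_of_nonneg_right h₂ hopt0)

/-- The upper bound on the cost of Smartstart. -/
theorem IsSmartstart.le_mul_opt (hc : 1 ≤ c) (hΘ : 2 ≤ Θ) {ρ : ℝ}
    (h₁ : f₁ Θ ≤ ρ) (h₂ : f₂ Θ ≤ ρ) (h0 : 1 ≤ ρ) {A : Input → ℝ} (hA : IsSmartstart c Θ A)
    (σ : Input) : A σ ≤ ρ * opt c σ := by
  have hopt0 : 0 ≤ opt c σ := L_nonneg c σ 0 0 univ
  refine (hA σ).le_mul_opt hc hΘ h₁ h₂ ⟨by simp, fun i _ => ?_, .inl rfl, fun _ => ?_,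
    fun _ _ => ?_⟩
  · simpa using mul_nonneg (by linarith) (σ.req i).rel_nonneg
  · positivity
  · change 0 + opt c σ ≤ ρ * opt c σ
    nlinarith

end DialARide

/-! ### Leading the server away from the origin -/

namespace DialARide

open Finset Filter Topology
open scoped ENNReal

variable {c : ℕ∞} {σ : Input} {Θ t t' p p' s T e : ℝ} {U W W' B : Finset (Fin σ.n)} {S : Plan σ}

namespace Serves

theorem mono (h : Serves c σ t p W' e) (hW : W ⊆ W') : Serves c σ t p W e := by
  obtain ⟨S, hS, he⟩ := h
  have h1 := hS.restrict W
  rw [inter_eq_right.2 hW, empty_inter] at h1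
  refine ⟨_, h1, le_trans ?_ he⟩
  rcases W.eq_empty_or_nonempty with rfl | hne
  · simpa [endTime] using hS.le_endTime
  · obtain ⟨i, -, hi, -⟩ := h1.exists_last (by simpa using hne)
    have h2 := hS.endTime_ge_of_mem (List.mem_of_mem_filter hi)
    linarith [abs_nonneg (endPos p S - (Stop.dropoff i).pos σ)]

theorem move (h : Serves c σ t' p' W e) (ht : t + |p' - p| ≤ t') : Serves c σ t p W e := by
  obtain ⟨S, hS, he⟩ := h
  exact ⟨S, hS.of_move ht, (endTime_mono (by linarith [abs_nonneg (p' - p)]) S).trans he⟩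

theorem step_of_subset (hc : 1 ≤ c) (i : Fin σ.n) {u : ℝ}
    (hu : t + |(σ.req i).src - p| ≤ u) (hr : (σ.req i).rel ≤ u)
    (hW : ∀ j ∈ W, j = i ∨ j ∈ W')
    (h : Serves c σ (u + |(σ.req i).dst - (σ.req i).src|) (σ.req i).dst W' e) :
    Serves c σ t p W e := by
  have h1 : Serves c σ t p (insert i W') e :=
    step hc (mem_insert_self i W') hu hr (h.mono (by
      intro j hj
      simp only [mem_erase, mem_insert] at hj
      tauto))
  exact h1.mono fun j hj => by simpa using hW j hj

end Serves

namespace SmartstartRun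

theorem exists_step (h : SmartstartRun c Θ σ t p U T) (hU : U.Nonempty) :
    ∃ s S, IsLeast (startTimes c Θ σ t p U) s ∧ IsSchedule c σ s p (pending σ U s) ∅ S ∧
      endTime s S - s = L c σ s p (pending σ U s) ∧
      SmartstartRun c Θ σ (endTime s S) (endPos p S) (U \ pending σ U s) T := by
  cases h with
  | done => simp at hU
  | step _ _ _ s S _ start sched optimal rest => exact ⟨s, S, start, sched, optimal, rest⟩

theorem le_time (h : SmartstartRun c Θ σ t p U T) : t ≤ T := by
  induction h with
  | done => exact le_rfl
  | step _ _ _ s S _ start sched _ _ ih => exact start.1.1.trans (sched.le_endTime.trans ih)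

theorem add_dist_le (h : SmartstartRun c Θ σ t p U T) {i : Fin σ.n} (hi : i ∈ U) :
    t + |(σ.req i).dst - p| ≤ T := by
  induction h with
  | done => simp at hi
  | step t p U s S T start sched _ rest ih =>
    have h1 := start.1.1
    by_cases hp : i ∈ pending σ U s
    · obtain ⟨_, v, -, hv, -, -⟩ := sched.exists_stops hp
      have h2 := sched.le_of_mem hv
      have h3 := sched.endTime_ge_of_mem hv
      have h4 := rest.le_time
      have h5 := abs_nonneg (endPos p S - (Stop.dropoff i).pos σ)
      simp only [Stop.pos] at h2 h5 h3
      linarith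
    · have h2 := ih (Finset.mem_sdiff.2 ⟨hi, hp⟩)
      have h3 := sched.dist_endPos_le
      have h4 := abs_sub_le (σ.req i).dst (endPos p S) p
      linarith

end SmartstartRun

/-- The transportation request from `a` to `b` with release time `|r|`. -/
def ride (a b r : ℝ) : Request := ⟨a, b, |r|, abs_nonneg r⟩

theorem ride_src (a b r : ℝ) : (ride a b r).src = a := rfl

theorem ride_dst (a b r : ℝ) : (ride a b r).dst = b := rfl

theorem ride_rel (a b r : ℝ) : (ride a b r).rel = |r| := rfl

/-- The `k`-th of the requests that lead the server away from the origin. -/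
noncomputable def leadRequest (q : ℝ) (k : ℕ) : Request :=
  ride (q ^ (k + 1) - 1) (q ^ (k + 1) - 1) (q ^ k)

/-- The input in which `K` requests lead the server away from the origin, followed by the requests
`f`. -/
noncomputable def runaway (q : ℝ) (K : ℕ) {m : ℕ} (f : Fin m → Request) : Input where
  n := K + m
  req := Fin.append (fun k : Fin K => leadRequest q k) f

section runaway

variable {q : ℝ} {K m : ℕ} {f : Fin m → Request}

theorem runaway_req_point (hq : 0 ≤ q) {k : ℕ} (hk : k < K) (hk' : k < (runaway q K f).n) :
    ((runaway q K f).req ⟨k, hk'⟩).src = q ^ (k + 1) - 1 ∧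
    ((runaway q K f).req ⟨k, hk'⟩).dst = q ^ (k + 1) - 1 ∧
    ((runaway q K f).req ⟨k, hk'⟩).rel = q ^ k := by
  have : (runaway q K f).req ⟨k, hk'⟩ = leadRequest q k :=
    Fin.append_left (fun k : Fin K => leadRequest q k) f ⟨k, hk⟩
  rw [this]
  exact ⟨rfl, rfl, abs_of_nonneg (pow_nonneg hq k)⟩

/-- The index of the `j`-th of the requests `f` in `runaway q K f`. -/
def late (j : Fin m) : Fin (runaway q K f).n := Fin.natAdd K j

theorem runaway_req_late (j : Fin m) : (runaway q K f).req (late j) = f j :=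
  Fin.append_right (fun k : Fin K => leadRequest q k) f j

theorem late_val (j : Fin m) : (late j : Fin (runaway q K f).n).1 = K + j.1 := rfl

theorem exists_eq_late {i : Fin (runaway q K f).n} (hi : K ≤ i.1) : ∃ j : Fin m, i = late j := by
  have h : i.1 < K + m := i.2
  exact ⟨⟨i.1 - K, by omega⟩, Fin.ext (by rw [late_val]; simp only; omega)⟩

/-- When request `k` appears at `q^k`, it is the only pending one and costs `(q - 1) * q^k ≤ (Θ - 1)
* q^k`, so the server leaves at once and arrives at `q^(k+1)`, in time for the next. Only at `k = 0`
may it have been idle earlier. -/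
theorem SmartstartRun.runaway (hc : 1 ≤ c) (hq : 1 < q) (hqΘ : q ≤ Θ)
    (hf : ∀ j, ∀ k < K, q ^ k < (f j).rel)
    (h : SmartstartRun c Θ (runaway q K f) 0 0 univ T) (k : ℕ) (hk : k ≤ K) :
    ∃ t ≤ q ^ k, (k ≠ 0 → t = q ^ k) ∧
      SmartstartRun c Θ (runaway q K f) t (q ^ k - 1) {i | k ≤ i.1} T := by
  have hΘ : 0 < Θ - 1 := by linarith
  have hq0 : 0 ≤ q := by linarith
  induction k with
  | zero => exact ⟨0, by simp, by simp, by simpa using h⟩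
  | succ k ih =>
    obtain ⟨t, htk, -, hrun⟩ := ih (by omega)
    have hkK : k < K := by omega
    let i₀ : Fin (DialARide.runaway q K f).n := ⟨k, by change k < K + m; omega⟩
    obtain ⟨hsrc, hdst, hrel⟩ := runaway_req_point (f := f) hq0 hkK i₀.2
    change ((DialARide.runaway q K f).req i₀).src = _ at hsrc
    change ((DialARide.runaway q K f).req i₀).dst = _ at hdst
    change ((DialARide.runaway q K f).req i₀).rel = _ at hrel
    have hge (i : Fin (DialARide.runaway q K f).n) (hi : k ≤ i.1) :
        q ^ k ≤ ((DialARide.runaway q K f).req i).rel ∧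
        (((DialARide.runaway q K f).req i).rel ≤ q ^ k → i = i₀) := by
      rcases lt_or_ge i.1 K with hiK | hiK
      · rw [(runaway_req_point (f := f) hq0 hiK i.2).2.2]
        refine ⟨pow_le_pow_right₀ hq.le hi, fun h => Fin.ext ?_⟩
        exact le_antisymm ((pow_le_pow_iff_right₀ hq).1 h) hi
      · obtain ⟨j, rfl⟩ := exists_eq_late hiK
        rw [runaway_req_late]
        exact ⟨(hf j k hkK).le, fun h => absurd h (not_le.2 (hf j k hkK))⟩
    have hpend : pending (DialARide.runaway q K f) {i | k ≤ i.1} (q ^ k) = {i₀} := by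
      ext i
      simp only [mem_pending, mem_filter, mem_univ, true_and, mem_singleton]
      constructor
      · exact fun h => (hge i h.1).2 h.2
      · rintro rfl
        exact ⟨le_rfl, hrel.le⟩
    have hmono : q ^ k ≤ q ^ (k + 1) := pow_le_pow_right₀ hq.le (Nat.le_succ k)
    have hdist : |q ^ (k + 1) - 1 - (q ^ k - 1)| = q ^ (k + 1) - q ^ k := by
      rw [abs_of_nonneg] <;> linarith
    have hL : L c (DialARide.runaway q K f) (q ^ k) (q ^ k - 1) {i₀} ≤ q ^ (k + 1) - q ^ k := by
      have : Serves c (DialARide.runaway q K f) (q ^ k) (q ^ k - 1) {i₀} (q ^ (k + 1)) := by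
        refine .step_of_subset (W' := ∅) (u := q ^ (k + 1)) hc i₀ ?_ ?_ (by simp) ?_
        · rw [hsrc, hdist]; linarith
        · rw [hrel]; exact hmono
        · rw [hsrc, hdst, sub_self, abs_zero, add_zero]
          exact serves_empty le_rfl
      exact this.L_le
    have hleast : IsLeast (startTimes c Θ (DialARide.runaway q K f) t (q ^ k - 1) {i | k ≤ i.1})
        (q ^ k) := by
      refine ⟨⟨htk, by simp [hpend], ?_⟩, ?_⟩
      · rw [hpend, div_le_iff₀ hΘ]
        refine hL.trans ?_
        rw [pow_succ]
        nlinarith [pow_nonneg hq0 k]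
      · rintro s ⟨-, ⟨i, hi⟩, -⟩
        simp only [mem_pending, mem_filter, mem_univ, true_and] at hi
        exact (hge i hi.1).1.trans hi.2
    obtain ⟨s, S, hs, hS, hopt, hrest⟩ := hrun.exists_step ⟨i₀, by simp [i₀]⟩
    obtain rfl := hs.unique hleast
    rw [hpend] at hS hopt hrest
    obtain ⟨i, hi, -, hend⟩ := hS.exists_last (by simp)
    obtain rfl : i = i₀ := by simpa using hi
    have h1 := hS.dist_endPos_le
    rw [hend, hdst, hdist] at h1
    rw [hend, hdst] at hrest
    have h2 : endTime (q ^ k) S = q ^ (k + 1) := by linarith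
    rw [h2] at hrest
    refine ⟨_, le_rfl, fun _ => rfl, ?_⟩
    convert hrest using 1
    ext i
    simp only [mem_filter, mem_univ, true_and, Finset.mem_sdiff, mem_singleton, Fin.ext_iff, i₀]
    omega

/-- The offline server can serve the leading requests on its way. -/
theorem serves_points (hc : 1 ≤ c) (hq : 1 ≤ q) {W W' : Finset (Fin (runaway q K f).n)}
    {k : ℕ} (hk : k ≤ K) (ht : q ^ (K - 1) ≤ t)
    (hW : ∀ i ∈ W, i ∈ W' ∨ k ≤ i.1 ∧ i.1 < K)
    (h : Serves c (runaway q K f) (t + (q ^ K - q ^ k)) (q ^ K - 1) W' e) :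
    Serves c (runaway q K f) t (q ^ k - 1) W e := by
  induction hn : K - k generalizing k t W with
  | zero =>
    obtain rfl : k = K := by omega
    rw [sub_self, add_zero] at h
    exact h.mono fun i hi => (hW i hi).resolve_right (by omega)
  | succ n ih =>
    have hkK : k < K := by omega
    have hmono : q ^ k ≤ q ^ (k + 1) := pow_le_pow_right₀ hq (Nat.le_succ k)
    let i₀ : Fin (runaway q K f).n := ⟨k, by change k < K + m; omega⟩
    obtain ⟨hsrc, hdst, hrel⟩ := runaway_req_point (f := f) (by linarith) hkK i₀.2
    refine .step_of_subset (W' := W.erase i₀) (u := t + (q ^ (k + 1) - q ^ k)) hc i₀ ?_ ?_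
      (fun j hj => by rw [mem_erase]; tauto) ?_
    · change t + |((runaway q K f).req ⟨k, _⟩).src - _| ≤ _
      rw [hsrc, abs_of_nonneg] <;> linarith
    · change ((runaway q K f).req ⟨k, _⟩).rel ≤ _
      rw [hrel]
      linarith [pow_le_pow_right₀ hq (by omega : k ≤ K - 1)]
    · change Serves _ _ (_ + |((runaway q K f).req ⟨k, _⟩).dst - ((runaway q K f).req ⟨k, _⟩).src|)
        ((runaway q K f).req ⟨k, _⟩).dst _ _
      rw [hsrc, hdst, sub_self, abs_zero, add_zero]
      refine ih (by omega) (by linarith) (fun i hi => ?_) (by convert h using 1; ring) (by omega)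
      rw [mem_erase, ne_eq, Fin.ext_iff] at hi
      refine (hW i hi.2).imp_right fun h => ⟨?_, h.2⟩
      simp only [i₀] at hi
      omega

end runaway

theorem le_competitiveRatio {A : Input → ℝ} {r : ℝ}
    (h : ∀ r' < r, ∃ σ e, 0 < e ∧ opt c σ ≤ e ∧ r' * e ≤ A σ) :
    ENNReal.ofReal r ≤ competitiveRatio c A := by
  refine le_sInf fun ρ hρ => ?_
  by_contra! hlt
  have hρt : ρ ≠ ⊤ := hlt.ne_top
  obtain ⟨r', h1, h2⟩ := exists_between ((ENNReal.lt_ofReal_iff_toReal_lt hρt).1 hlt)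
  obtain ⟨σ, e, he0, he, hA⟩ := h r' h2
  have h3 : ENNReal.ofReal (A σ) ≤ ρ * ENNReal.ofReal e := (hρ σ).trans (by gcongr)
  rw [← ENNReal.ofReal_toReal hρt, ← ENNReal.ofReal_mul ENNReal.toReal_nonneg,
    ENNReal.ofReal_le_ofReal_iff (by positivity)] at h3
  nlinarith

/-- An additive loss `C` is negligible on inputs with arbitrarily large `e`. -/
theorem le_competitiveRatio_of_sub_le {A : Input → ℝ} {r C : ℝ}
    (h : ∀ N : ℝ, ∃ σ e, N ≤ e ∧ opt c σ ≤ e ∧ r * e - C ≤ A σ) :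
    ENNReal.ofReal r ≤ competitiveRatio c A := by
  refine le_competitiveRatio fun r' hr' => ?_
  obtain ⟨σ, e, hN, he, hA⟩ := h (max 1 (C / (r - r')))
  have he2 := (le_max_right _ _).trans hN
  rw [div_le_iff₀ (sub_pos.2 hr')] at he2
  exact ⟨σ, e, one_pos.trans_le ((le_max_left _ _).trans hN), he, by linarith⟩

end DialARide

/-! ### Decoy inputs, on which Smartstart is lured to the left -/

namespace DialARide

open Finset Filter Topology
open scoped ENNReal

variable {c : ℕ∞} {σ : Input} {Θ t t' p p' s T e : ℝ} {U W W' B : Finset (Fin σ.n)} {S : Plan σ}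

section decoy

variable {q y α β a r m ℓ : ℝ} {K : ℕ}

/-- The input in which the server is led away from the origin, must then serve a request at `-y`
and a ride from `α` to `β`, and finally a request at `a` that appears at time `r`. -/
noncomputable abbrev decoy (q : ℝ) (K : ℕ) (y α β a r : ℝ) : Input :=
  runaway q K ![ride (-y) (-y) y, ride α β y, ride a a r]

/-- A schedule for the request at `-y` and the ride from `α` to `β`. -/
theorem decoy_schedule {z : ℝ} {S : Plan (decoy q K y α β a r)}
    (hℓ : ℓ = |α - z| + |β - α| + |y + β|) (hℓ' : ℓ < |y + z| + |y + β|)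
    (hS : IsSchedule c (decoy q K y α β a r) s z {late 0, late 1} ∅ S) :
    ℓ ≤ endTime s S - s ∧ (endTime s S - s ≤ ℓ → endPos z S = -y) := by
  have hY : (decoy q K y α β a r).req (late 0) = ride (-y) (-y) y := runaway_req_late _
  have hW : (decoy q K y α β a r).req (late 1) = ride α β y := runaway_req_late _
  obtain ⟨i, hi, -, hend⟩ := hS.exists_last (by simp)
  simp only [union_empty, mem_insert, mem_singleton] at hi
  rcases hi with rfl | rfl
  · obtain ⟨u, v, hu, hv, -, huv⟩ := hS.exists_stops (i := late 1) (by simp)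
    have h1 := hS.le_of_mem hu
    have h2 := hS.endTime_ge_of_mem hv
    rw [hY] at hend
    rw [hend] at h2 ⊢
    simp only [Stop.pos, hW, ride_src, ride_dst] at h1 h2 huv
    rw [show -y - β = -(y + β) by ring, abs_neg] at h2
    exact ⟨by linarith, fun _ => rfl⟩
  · obtain ⟨u, v, -, hv, -, -⟩ := hS.exists_stops (i := late 0) (by simp)
    have h1 := hS.le_of_mem hv
    have h2 := hS.endTime_ge_of_mem hv
    rw [hW] at hend
    rw [hend] at h2
    simp only [Stop.pos, hY, ride_dst] at h1 h2
    rw [show -y - z = -(y + z) by ring, abs_neg] at h1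
    rw [show β - -y = y + β by ring] at h2
    exact ⟨by linarith, fun h => by linarith⟩

/-- `hℓ'` makes the order "ride, then `-y`" strictly better than its reverse, so every tie-breaking
rule ends at `-y`. The server starts at `m` and the last request appears afterwards, so it must
still cross from `-y` to `a`. -/
theorem SmartstartRun.decoy_le (hc : 1 ≤ c) (hq : 1 < q) (hqΘ : q ≤ Θ) (hK : K ≠ 0)
    (hy : ∀ k < K, q ^ k < y) (hm₁ : q ^ K ≤ m) (hm₂ : y ≤ m) (hm₃ : ℓ ≤ (Θ - 1) * m)
    (hm₄ : m ≤ q ^ K ∨ (Θ - 1) * m ≤ ℓ) (hr : m < r)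
    (hℓ : ℓ = |α - (q ^ K - 1)| + |β - α| + |y + β|) (hℓ' : ℓ < |y + (q ^ K - 1)| + |y + β|)
    (h : SmartstartRun c Θ (decoy q K y α β a r) 0 0 univ T) : m + ℓ + |a + y| ≤ T := by
  have hΘ : 0 < Θ - 1 := by linarith
  have hy0 : 0 < y := (pow_pos (by linarith) 0).trans (hy 0 (Nat.pos_of_ne_zero hK))
  have hY : (decoy q K y α β a r).req (late 0) = ride (-y) (-y) y := runaway_req_late _
  have hW : (decoy q K y α β a r).req (late 1) = ride α β y := runaway_req_late _
  have hF : (decoy q K y α β a r).req (late 2) = ride a a r := runaway_req_late _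
  obtain ⟨t, -, ht, hrun⟩ := h.runaway hc hq hqΘ (fun j k hk => by
    have hym := hy k hk
    fin_cases j <;> simp only <;> refine lt_of_lt_of_le ?_ (le_abs_self _)
    exacts [hym, hym, by linarith]) K le_rfl
  obtain rfl := ht hK
  change SmartstartRun c Θ (decoy q K y α β a r) _ _ _ T at hrun
  have hpend (s : ℝ) (h1 : y ≤ s) (h2 : s ≤ m) :
      pending (decoy q K y α β a r) {i | K ≤ i.1} s = {late 0, late 1} := by
    ext i
    simp only [mem_pending, mem_filter, mem_univ, true_and, mem_insert, mem_singleton]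
    constructor
    · rintro ⟨hi, hr'⟩
      obtain ⟨j, rfl⟩ := exists_eq_late hi
      fin_cases j
      · exact .inl rfl
      · exact .inr rfl
      · change ((decoy q K y α β a r).req (late 2)).rel ≤ s at hr'
        rw [hF] at hr'
        linarith [(le_abs_self r).trans hr']
    · rintro (rfl | rfl)
      · exact ⟨Nat.le_add_right _ _, by rw [hY]; simpa [ride_rel, abs_of_pos hy0] using h1⟩
      · exact ⟨Nat.le_add_right _ _, by rw [hW]; simpa [ride_rel, abs_of_pos hy0] using h1⟩
  have hLm : L c (decoy q K y α β a r) m (q ^ K - 1) {late 0, late 1} ≤ ℓ := by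
    have : Serves c (decoy q K y α β a r) m (q ^ K - 1) {late 0, late 1} (m + ℓ) := by
      refine .step_of_subset (W' := {late 0}) (u := m + |α - (q ^ K - 1)|) hc (late 1) ?_ ?_
        (by simp) (.step_of_subset (W' := ∅) (u := m + ℓ) hc (late 0) ?_ ?_ (by simp) ?_) <;>
        simp only [hY, hW, ride_src, ride_dst, ride_rel, abs_of_pos hy0]
      · exact le_rfl
      · linarith [abs_nonneg (α - (q ^ K - 1))]
      · rw [show -y - β = -(y + β) by ring, abs_neg, hℓ]
        linarith
      · rw [hℓ]
        linarith [abs_nonneg (α - (q ^ K - 1)), abs_nonneg (β - α), abs_nonneg (y + β)]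
      · exact serves_empty (by simp)
    linarith [this.L_le]
  have hLge (s : ℝ) : ℓ ≤ L c (decoy q K y α β a r) s (q ^ K - 1) {late 0, late 1} := by
    obtain ⟨S, hS, hE⟩ := exists_optimal (σ := decoy q K y α β a r) hc s (q ^ K - 1)
      {late 0, late 1}
    rw [← hE]
    exact (decoy_schedule hℓ hℓ' hS).1
  have hleast : IsLeast (startTimes c Θ (decoy q K y α β a r) (q ^ K) (q ^ K - 1)
      {i | K ≤ i.1}) m := by
    refine ⟨⟨hm₁, by simp [hpend m hm₂ le_rfl], ?_⟩, ?_⟩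
    · rw [hpend m hm₂ le_rfl, div_le_iff₀ hΘ]
      linarith
    · rintro s ⟨hts, ⟨i, hi⟩, hle⟩
      by_contra! hsm
      have hys : y ≤ s := by
        simp only [mem_pending, mem_filter, mem_univ, true_and] at hi
        obtain ⟨hi, hr'⟩ := hi
        obtain ⟨j, rfl⟩ := exists_eq_late hi
        fin_cases j
        · change ((decoy q K y α β a r).req (late 0)).rel ≤ s at hr'
          rw [hY] at hr'
          exact (le_abs_self y).trans hr'
        · change ((decoy q K y α β a r).req (late 1)).rel ≤ s at hr'
          rw [hW] at hr'
          exact (le_abs_self y).trans hr'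
        · change ((decoy q K y α β a r).req (late 2)).rel ≤ s at hr'
          rw [hF] at hr'
          linarith [(le_abs_self r).trans hr']
      -- Before `m` the two decoy requests already cost `ℓ`, so starting then would violate either
      -- the waiting condition or the idle time `q ^ K`.
      rw [hpend s hys hsm.le, div_le_iff₀ hΘ] at hle
      have := hLge s
      rcases hm₄ with hm₄ | hm₄
      · linarith
      · nlinarith
  obtain ⟨s, S, hs, hS, hopt, hrest⟩ := hrun.exists_step ⟨late 0, by simp [late_val]⟩
  obtain rfl := hs.unique hleast
  rw [hpend s hm₂ le_rfl] at hS hopt hrest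
  obtain ⟨h1, h2⟩ := decoy_schedule hℓ hℓ' hS
  have h3 := hrest.add_dist_le (i := late 2) (by simp [late_val, Fin.ext_iff])
  rw [h2 (by linarith), hF] at h3
  simp only [ride_dst, sub_neg_eq_add] at h3
  linarith

/-- The offline server can first serve the request at `-y` and then run to the right. -/
theorem decoy_serves (hc : 1 ≤ c) (hy : 0 ≤ y) {W' : Finset (Fin (decoy q K y α β a r).n)}
    (hW' : ∀ i, i = late 0 ∨ i ∈ W') (h : Serves c (decoy q K y α β a r) y (-y) W' e) :
    Serves c (decoy q K y α β a r) 0 0 univ e := by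
  have hY : (decoy q K y α β a r).req (late 0) = ride (-y) (-y) y := runaway_req_late _
  refine .step_of_subset (W' := W') (u := y) hc (late 0) ?_ ?_ (fun i _ => hW' i) ?_ <;>
    simp only [hY, ride_src, ride_dst, ride_rel, sub_zero, abs_neg, abs_of_nonneg hy, sub_self,
      abs_zero, add_zero]
  · linarith
  · exact le_rfl
  · exact h

theorem decoy_opt_le_of_point (hc : 1 ≤ c) (hq : 1 ≤ q) (hy : q ^ (K - 1) ≤ y)
    (hα : q ^ K - 1 ≤ α) (ha : α ≤ a) (hr : r = 2 * y + a) :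
    opt c (decoy q K y α α a r) ≤ r := by
  have hy0 : 0 < y := (pow_pos (by linarith) _).trans_le hy
  have hqK : 1 ≤ q ^ K := one_le_pow₀ hq
  have hW : (decoy q K y α α a r).req (late 1) = ride α α y := runaway_req_late _
  have hF : (decoy q K y α α a r).req (late 2) = ride a a r := runaway_req_late _
  have h : Serves c (decoy q K y α α a r) 0 0 univ r := by
    refine decoy_serves hc hy0.le (W' := univ.erase (late 0)) (fun i => by simp; tauto) ?_
    refine .move (t' := 2 * y) (p' := q ^ 0 - 1) ?_ (by simp [abs_of_pos hy0]; linarith)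
    refine serves_points (W' := {late 1, late 2}) hc hq (Nat.zero_le K) (by linarith) ?_ ?_
    · intro i hi
      rcases lt_or_ge i.1 K with h | h
      · exact .inr ⟨Nat.zero_le _, h⟩
      · obtain ⟨j, rfl⟩ := exists_eq_late h
        fin_cases j
        · simp at hi
        · exact .inl (mem_insert_self _ _)
        · exact .inl (mem_insert_of_mem (mem_singleton_self _))
    · change Serves c (decoy q K y α α a r) _ _ _ r
      refine .step_of_subset (W' := {late 2}) (u := 2 * y + α) hc (late 1) ?_ ?_ (by simp)
        (.step_of_subset (W' := ∅) (u := r) hc (late 2) ?_ ?_ (by simp) ?_) <;>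
        simp only [hW, hF, ride_src, ride_dst, ride_rel, sub_self, abs_zero, add_zero]
      · rw [abs_of_nonneg (by linarith)]; simp
      · rw [abs_of_pos hy0]; linarith
      · rw [abs_of_nonneg (by linarith)]; linarith
      · rw [abs_of_nonneg (by linarith)]
      · exact serves_empty le_rfl
  linarith [show opt c _ ≤ _ from h.L_le]

theorem decoy_opt_le_of_ride (hc : 1 ≤ c) (hq : 1 ≤ q) (hy : 1 ≤ y) (hα : -y ≤ α)
    (hα' : α ≤ q - 1) (ha : q - 1 ≤ a) (hr : r = 2 * y + a) :
    opt c (decoy q 1 y α (q - 1) a r) ≤ r := by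
  have hy0 : 0 < y := by linarith
  have hW : (decoy q 1 y α (q - 1) a r).req (late 1) = ride α (q - 1) y := runaway_req_late _
  have hF : (decoy q 1 y α (q - 1) a r).req (late 2) = ride a a r := runaway_req_late _
  have h : Serves c (decoy q 1 y α (q - 1) a r) 0 0 univ r := by
    refine decoy_serves hc hy0.le (W' := univ.erase (late 0)) (fun i => by simp; tauto) ?_
    obtain ⟨hsrc, hdst, hrel⟩ := runaway_req_point (q := q) (K := 1)
      (f := ![ride (-y) (-y) y, ride α (q - 1) y, ride a a r]) (by linarith) Nat.one_pos
      (by change 0 < 1 + 3; omega)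
    have hset : ∀ i ∈ univ.erase (late 0), i = late 1 ∨
        i ∈ ({⟨0, by change 0 < 1 + 3; omega⟩, late 2} :
          Finset (Fin (decoy q 1 y α (q - 1) a r).n)) := by
      intro i hi
      rcases lt_or_ge i.1 1 with h | h
      · exact .inr (mem_insert.2 (.inl (Fin.ext (by simpa using h))))
      · obtain ⟨j, rfl⟩ := exists_eq_late h
        fin_cases j
        · simp at hi
        · exact .inl rfl
        · exact .inr (by simp)
    refine .step_of_subset (W' := {⟨0, by change 0 < 1 + 3; omega⟩, late 2})
      (u := 2 * y + α) hc (late 1) ?_ ?_ hset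
      (.step_of_subset (W' := {late 2}) (u := 2 * y + (q - 1)) hc
        ⟨0, by change 0 < 1 + 3; omega⟩ ?_ ?_ (by simp)
        (.step_of_subset (W' := ∅) (u := r) hc (late 2) ?_ ?_ (by simp) ?_)) <;>
      simp only [hW, hF, hsrc, hdst, hrel, ride_src, ride_dst, ride_rel, sub_self, abs_zero,
        add_zero, zero_add, pow_one, pow_zero]
    · rw [abs_of_nonneg (by linarith)]; linarith
    · rw [abs_of_pos hy0]; linarith
    · rw [abs_of_nonneg (by linarith)]; linarith
    · linarith
    · rw [abs_of_nonneg (by linarith)]; linarith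
    · rw [abs_of_nonneg (by linarith)]
    · exact serves_empty le_rfl
  linarith [show opt c _ ≤ _ from h.L_le]

end decoy

end DialARide

/-! ### Shuttle inputs and the lower bounds -/

namespace DialARide

open Finset Filter Topology
open scoped ENNReal

variable {c : ℕ∞} {σ : Input} {Θ t t' p p' s T e : ℝ} {U W W' B : Finset (Fin σ.n)} {S : Plan σ}

/-- The total variation of `φ` along the stops of a plan that is begun at position `p`. -/
def variation (φ : ℝ → ℝ) : ℝ → Plan σ → ℝ
  | _, [] => 0
  | p, (_, e) :: S => |φ (e.pos σ) - φ p| + variation φ (e.pos σ) S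

namespace IsSchedule

theorem le_variation_of_mem_load (h : IsSchedule c σ t p W B S) (φ : ℝ → ℝ) {i : Fin σ.n}
    (hi : i ∈ B) : |φ (σ.req i).dst - φ p| ≤ variation φ p S := by
  induction S generalizing t p W B with
  | nil => rw [isSchedule_nil] at h; simp [h.2] at hi
  | cons a S ih =>
    obtain ⟨s, j⟩ := a
    have h1 := abs_sub_le (φ (σ.req i).dst) (φ (j.pos σ)) (φ p)
    have h2 : 0 ≤ variation φ (j.pos σ) S := by
      generalize j.pos σ = x
      clear * -
      induction S generalizing x with
      | nil => exact le_rfl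
      | cons a S ih => exact add_nonneg (abs_nonneg _) (ih _)
    simp only [variation]
    obtain j | j := j <;> simp only [Stop.pos] at h1 h2 ⊢
    · linarith [ih (isSchedule_pickup.1 h).2.2.2.2 (mem_insert_of_mem hi)]
    · by_cases hij : i = j
      · subst hij
        exact le_add_of_nonneg_right h2
      · linarith [ih (isSchedule_dropoff.1 h).2.2 (mem_erase.2 ⟨hij, hi⟩)]

/-- The server must reach the source and then carry the request to its destination; measured through
`φ`, this isolates the travel inside one segment of the line. -/
theorem le_variation_of_mem (h : IsSchedule c σ t p W B S) (φ : ℝ → ℝ) {i : Fin σ.n}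
    (hi : i ∈ W) :
    |φ (σ.req i).src - φ p| + |φ (σ.req i).dst - φ (σ.req i).src| ≤ variation φ p S := by
  induction S generalizing t p W B with
  | nil => rw [isSchedule_nil] at h; simp [h.1] at hi
  | cons a S ih =>
    obtain ⟨s, j⟩ := a
    have h1 := abs_sub_le (φ (σ.req i).src) (φ (j.pos σ)) (φ p)
    simp only [variation]
    obtain j | j := j <;> simp only [Stop.pos] at h1 ⊢
    · have h' := (isSchedule_pickup.1 h).2.2.2.2
      by_cases hij : i = j
      · subst hij
        exact add_le_add_right (h'.le_variation_of_mem_load φ (mem_insert_self _ _)) _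
      · linarith [ih h' (mem_erase.2 ⟨hij, hi⟩)]
    · linarith [ih (isSchedule_dropoff.1 h).2.2 hi]

theorem sum_variation_le {ι : Type*} {J : Finset ι} {φ : ι → ℝ → ℝ}
    (hφ : ∀ a b, ∑ j ∈ J, |φ j a - φ j b| ≤ |a - b|) (h : IsSchedule c σ t p W B S) :
    ∑ j ∈ J, variation (φ j) p S ≤ endTime t S - t := by
  induction S generalizing t p W B with
  | nil => simp [variation, endTime]
  | cons a S ih =>
    obtain ⟨s, e⟩ := a
    obtain ⟨W', B', h'⟩ := h.tail
    simp only [variation, endTime, sum_add_distrib]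
    linarith [ih h', hφ (e.pos σ) p, h.head_le]

end IsSchedule

theorem min_sub_min_le {a b y y' : ℝ} (hab : b ≤ a) (hy : y ≤ y') :
    min b y' - min b y ≤ min a y' - min a y := by
  rcases le_total b y' with h1 | h1 <;> rcases le_total b y with h2 | h2 <;>
    rcases le_total a y' with h3 | h3 <;> rcases le_total a y with h4 | h4 <;>
    simp only [min_eq_left, min_eq_right, h1, h2, h3, h4] <;> linarith

/-- The lengths of the intersections of an interval with consecutive intervals add up to at most
its length. -/
theorem sum_abs_min_sub_le {y : ℕ → ℝ} (hy : Monotone y) (K : ℕ) (a b : ℝ) :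
    ∑ j ∈ range K, |(min a (y (j + 1)) - min a (y j)) - (min b (y (j + 1)) - min b (y j))| ≤
      |a - b| := by
  wlog hab : b ≤ a generalizing a b
  · rw [abs_sub_comm a b]
    refine le_trans (le_of_eq (sum_congr rfl fun j _ => abs_sub_comm _ _)) (this b a ?_)
    exact (not_le.1 hab).le
  have h1 : ∀ j ∈ range K,
      |(min a (y (j + 1)) - min a (y j)) - (min b (y (j + 1)) - min b (y j))| =
      (min a (y (j + 1)) - min b (y (j + 1))) - (min a (y j) - min b (y j)) := by
    intro j _
    rw [abs_of_nonneg (sub_nonneg.2 (min_sub_min_le hab (hy (Nat.le_succ j))))]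
    ring
  rw [sum_congr rfl h1, sum_range_sub (fun j => min a (y j) - min b (y j)),
    abs_of_nonneg (sub_nonneg.2 hab)]
  have h2 : min b (y 0) ≤ min a (y 0) := min_le_min_right _ hab
  have h3 : min a (y K) - min b (y K) ≤ a - b := by
    rcases le_total a (y K) with h | h
    · rw [min_eq_left h, min_eq_left (hab.trans h)]
    · rw [min_eq_right h]
      rcases le_total b (y K) with h' | h' <;> simp only [min_eq_left, min_eq_right, h'] <;>
        linarith
  linarith

section shuttle

variable {q : ℝ} {K : ℕ}

/-- The end points of the rides in `shuttle q K`. -/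
noncomputable def shuttlePos (q : ℝ) (K k : ℕ) : ℝ := if k = 0 then -q ^ (K - 1) else q ^ k - 1

theorem shuttlePos_zero : shuttlePos q K 0 = -q ^ (K - 1) := if_pos rfl

theorem shuttlePos_succ (k : ℕ) : shuttlePos q K (k + 1) = q ^ (k + 1) - 1 := if_neg (by simp)

theorem shuttlePos_mono (hq : 1 ≤ q) : Monotone (shuttlePos q K) := by
  refine monotone_nat_of_le_succ fun k => ?_
  have h1 : (1 : ℝ) ≤ q ^ (k + 1) := one_le_pow₀ hq
  rcases k with _ | k
  · rw [shuttlePos_zero, shuttlePos_succ]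
    have : 0 ≤ q ^ (K - 1) := by positivity
    linarith
  · rw [shuttlePos_succ, shuttlePos_succ]
    exact sub_le_sub_right (pow_le_pow_right₀ hq (Nat.le_succ (k + 1))) 1

/-- The input in which the server is led to the position `q ^ K - 1` and then has to serve a
sequence of rides that lead from the position `-q ^ (K - 1)` to its own position. -/
noncomputable abbrev shuttle (q : ℝ) (K : ℕ) : Input :=
  runaway q K fun j : Fin K =>
    ride (shuttlePos q K j.1) (shuttlePos q K (j.1 + 1)) (q ^ (K - 1) + 1)

theorem shuttle_req (j : Fin K) : (shuttle q K).req (late j) =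
    ride (shuttlePos q K j.1) (shuttlePos q K (j.1 + 1)) (q ^ (K - 1) + 1) :=
  runaway_req_late j

theorem shuttle_schedule (hq : 1 ≤ q) (hK : K ≠ 0) {S : Plan (shuttle q K)}
    (hS : IsSchedule c (shuttle q K) s (q ^ K - 1) {i | K ≤ i.1} ∅ S) :
    2 * (q ^ K - 1 + q ^ (K - 1)) ≤ endTime s S - s := by
  have hy := shuttlePos_mono (K := K) hq
  -- Each segment is measured by its own clipped coordinate. The server starts to the right of all
  -- segments and must traverse each one leftwards and then rightwards, whatever the order of the
  -- rides.
  refine le_trans ?_ (hS.sum_variation_le (sum_abs_min_sub_le hy K))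
  obtain ⟨k, rfl⟩ := Nat.exists_eq_succ_of_ne_zero hK
  have h1 : ∀ j ∈ range (k + 1), 2 * (shuttlePos q (k + 1) (j + 1) - shuttlePos q (k + 1) j) ≤
      variation (fun a => min a (shuttlePos q (k + 1) (j + 1)) - min a (shuttlePos q (k + 1) j))
        (q ^ (k + 1) - 1) S := by
    intro j hj
    have hj' : j < k + 1 := mem_range.1 hj
    have h2 := hS.le_variation_of_mem
      (fun a => min a (shuttlePos q (k + 1) (j + 1)) - min a (shuttlePos q (k + 1) j))
      (i := late ⟨j, hj'⟩) (mem_filter.2 ⟨mem_univ _, Nat.le_add_right _ _⟩)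
    have h3 := hy (Nat.le_succ j)
    have h4 := hy (Nat.succ_le_of_lt hj')
    rw [Nat.succ_eq_add_one] at h3 h4
    rw [Nat.succ_eq_add_one, shuttlePos_succ k] at h4
    rw [shuttle_req] at h2
    simp only [ride_src, ride_dst, min_self, min_eq_left h3, min_eq_right h3,
      min_eq_right h4, min_eq_right (h3.trans h4), sub_self, zero_sub, sub_zero, abs_neg,
      abs_of_nonneg (sub_nonneg.2 h3)] at h2
    linarith
  refine le_trans (le_of_eq ?_) (sum_le_sum h1)
  rw [← mul_sum, sum_range_sub, shuttlePos_succ, shuttlePos_zero, sub_neg_eq_add]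

/-- The rides are cut at the positions of the leading requests, so a server of capacity `1` is empty
there and serves everything in one sweep to the right. -/
theorem shuttle_serves (hc : 1 ≤ c) (hq : 1 ≤ q) {k : ℕ} (hk : k ≤ K)
    {W : Finset (Fin (shuttle q K).n)} (hW : ∀ i ∈ W, k ≤ i.1 ∧ i.1 < K ∨ K + k ≤ i.1)
    (ht : q ^ (K - 1) + 1 ≤ t) :
    Serves c (shuttle q K) t (shuttlePos q K k) W
      (t + (shuttlePos q K K - shuttlePos q K k)) := by
  induction hn : K - k generalizing k t W with
  | zero =>
    obtain rfl : k = K := by omega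
    have : W = ∅ := eq_empty_of_forall_notMem fun i hi => by
      have := hW i hi
      have h2 : i.1 < k + k := i.2
      omega
    rw [this]
    exact serves_empty (by simp)
  | succ n ih =>
    have hkK : k < K := by omega
    have hmono := shuttlePos_mono (K := K) hq (Nat.le_succ k)
    have hpos : 0 ≤ q ^ (K - 1) := by positivity
    rw [Nat.succ_eq_add_one] at hmono
    have hn1 : k < (shuttle q K).n := by change k < K + K; omega
    obtain ⟨hsrc, hdst, hrel⟩ := runaway_req_point (K := K) (f := fun j : Fin K =>
      ride (shuttlePos q K j.1) (shuttlePos q K (j.1 + 1)) (q ^ (K - 1) + 1))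
      (by linarith) hkK hn1
    rw [← shuttlePos_succ (K := K)] at hsrc hdst
    have hreq := shuttle_req (q := q) ⟨k, hkK⟩
    refine .step_of_subset (W' := W.erase (late ⟨k, hkK⟩)) (u := t) hc (late ⟨k, hkK⟩) ?_ ?_
      (fun j hj => by rw [mem_erase]; tauto)
      (.step_of_subset (W' := (W.erase (late ⟨k, hkK⟩)).erase ⟨k, hn1⟩)
        (u := t + (shuttlePos q K (k + 1) - shuttlePos q K k)) hc ⟨k, hn1⟩ ?_ ?_
        (fun j hj => by rw [mem_erase]; tauto) ?_)
    · simp [hreq, ride_src]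
    · rw [hreq, ride_rel]
      exact (abs_of_nonneg (add_nonneg hpos zero_le_one)).trans_le ht
    · rw [hreq, hsrc, ride_src, ride_dst, abs_of_nonneg (sub_nonneg.2 hmono)]
      simp
    · rw [hrel]
      linarith [pow_le_pow_right₀ hq (by omega : k ≤ K - 1)]
    · rw [hsrc, hdst, sub_self, abs_zero, add_zero]
      convert ih (k := k + 1) (t := t + (shuttlePos q K (k + 1) - shuttlePos q K k)) (by omega)
        (fun i hi => ?_) (by linarith) (by omega) using 1
      · ring
      · simp only [mem_erase, ne_eq, Fin.ext_iff, late_val] at hi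
        have := hW i hi.2.2
        omega

theorem shuttle_opt_le (hc : 1 ≤ c) (hq : 1 ≤ q) (hK : K ≠ 0) :
    opt c (shuttle q K) ≤ (q + 2) * q ^ (K - 1) := by
  have hpos : 0 ≤ q ^ (K - 1) := by positivity
  have h := (shuttle_serves (q := q) (K := K) hc hq (Nat.zero_le K) (W := univ)
    (fun i _ => by omega) le_rfl).move (t := 0) (p := 0)
    (by rw [shuttlePos_zero, sub_zero, abs_neg, abs_of_nonneg hpos]; linarith)
  obtain ⟨k, rfl⟩ := Nat.exists_eq_succ_of_ne_zero hK
  rw [Nat.succ_eq_add_one, shuttlePos_succ, shuttlePos_zero] at h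
  simp only [Nat.succ_eq_add_one, Nat.add_sub_cancel] at h ⊢
  have h2 := h.L_le
  rw [pow_succ] at h2
  change opt c _ ≤ _ at h2
  linarith

theorem SmartstartRun.shuttle_le (hc : 1 ≤ c) (hΘ : 1 < Θ) (hK : K ≠ 0)
    (h : SmartstartRun c Θ (shuttle Θ K) 0 0 univ T) :
    Θ / (Θ - 1) * (2 * (Θ ^ K - 1 + Θ ^ (K - 1))) ≤ T := by
  have hΘ' : 0 < Θ - 1 := sub_pos.2 hΘ
  have hpos : 0 ≤ Θ ^ (K - 1) := by positivity
  obtain ⟨t, -, -, hrun⟩ := h.runaway hc hΘ le_rfl (fun j k hk => by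
    rw [ride_rel, abs_of_nonneg (by linarith)]
    linarith [pow_le_pow_right₀ hΘ.le (by omega : k ≤ K - 1)]) K le_rfl
  change SmartstartRun c Θ (shuttle Θ K) _ _ _ T at hrun
  obtain ⟨s, S, hs, hS, hopt, hrest⟩ := hrun.exists_step
    ⟨late ⟨0, Nat.pos_of_ne_zero hK⟩, by simp [late_val]⟩
  -- All rides share one release time, so they are started together.
  have hpend : pending (shuttle Θ K) {i | K ≤ i.1} s =
      ({i | K ≤ i.1} : Finset (Fin (shuttle Θ K).n)) := by
    obtain ⟨i, hi⟩ := hs.1.2.1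
    simp only [mem_pending, mem_filter, mem_univ, true_and] at hi
    ext i'
    simp only [mem_pending, mem_filter, mem_univ, true_and, and_iff_left_iff_imp]
    intro hi'
    obtain ⟨j, rfl⟩ := exists_eq_late hi.1
    obtain ⟨j', rfl⟩ := exists_eq_late hi'
    rw [shuttle_req, ride_rel] at hi ⊢
    exact hi.2
  have hle := hs.1.2.2
  rw [div_le_iff₀ hΘ', ← hopt] at hle
  rw [hpend] at hS
  have h1 := shuttle_schedule hΘ.le hK hS
  have h2 := hrest.le_time
  rw [div_mul_eq_mul_div, div_le_iff₀ hΘ']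
  nlinarith

end shuttle

/-- The lower bound for runs in which Smartstart waits before its last schedule. -/
theorem f₁_le_competitiveRatio (hc : 1 ≤ c) (hΘ : 1 < Θ) {A : Input → ℝ}
    (hA : IsSmartstart c Θ A) : ENNReal.ofReal (f₁ Θ) ≤ competitiveRatio c A := by
  refine le_competitiveRatio_of_sub_le (C := 2 * Θ / (Θ - 1)) fun N => ?_
  obtain ⟨n, hn⟩ := pow_unbounded_of_one_lt N hΘ
  have hΘ' : 0 < Θ - 1 := sub_pos.2 hΘ
  have h1 : 0 < Θ ^ n := by positivity
  refine ⟨shuttle Θ (n + 1), (Θ + 2) * Θ ^ n, by nlinarith,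
    shuttle_opt_le hc hΘ.le (Nat.add_one_ne_zero n), ?_⟩
  refine le_of_eq_of_le ?_ ((hA (shuttle Θ (n + 1))).shuttle_le hc hΘ (Nat.add_one_ne_zero n))
  have h2 : f₁ Θ = 2 * Θ * (Θ + 1) / ((Θ - 1) * (Θ + 2)) := by
    unfold f₁
    congr 1 <;> ring
  rw [h2, Nat.add_sub_cancel, pow_succ]
  have h3 : Θ + 2 ≠ 0 := by linarith
  field_simp
  ring

/-- The lower bound for runs in which Smartstart does not wait before its last schedule. -/
theorem f₂_le_competitiveRatio (hc : 1 ≤ c) (hΘ : 2 ≤ Θ) (hΘ' : Θ ≤ 9 / 4) {A : Input → ℝ}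
    (hA : IsSmartstart c Θ A) : ENNReal.ofReal (f₂ Θ) ≤ competitiveRatio c A := by
  refine le_competitiveRatio_of_sub_le (C := f₂ Θ + 2 / (3 * Θ + 3)) fun N => ?_
  obtain ⟨n, hn⟩ := pow_unbounded_of_one_lt (max N 2) (by linarith : 1 < Θ)
  have hN := (le_max_left _ _).trans hn.le
  have h2 := (le_max_right _ _).trans hn.le
  have hΘ0 : 0 < Θ - 1 := by linarith
  have hK : Θ ^ (n + 1) = Θ * Θ ^ n := pow_succ' Θ n
  set τ := Θ ^ n with hτ
  -- `m` is the time at which the waiting condition for the decoy of cost `(3 * Θ + 3) * τ - 2`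
  -- becomes tight.
  obtain ⟨m, hm⟩ : ∃ m, (Θ - 1) * m = (3 * Θ + 3) * τ - 2 :=
    ⟨((3 * Θ + 3) * τ - 2) / (Θ - 1), by field_simp⟩
  have hm₁ : Θ * τ ≤ m := by
    by_contra! hcon
    have := mul_lt_mul_of_pos_left hcon hΘ0
    nlinarith [mul_nonneg (by linarith : (0:ℝ) ≤ τ - 2)
      (by nlinarith : (0:ℝ) ≤ 3 * Θ + 3 - (Θ - 1) * Θ)]
  -- This puts `a` to the right of `w`. It needs `Θ^2 - Θ - 3 ≤ 0`, which `Θ ≤ 9 / 4` ensures.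
  have hm₂ : (2 * Θ + 3) * τ - 1 ≤ m := by
    by_contra! hcon
    have := mul_lt_mul_of_pos_left hcon hΘ0
    nlinarith [mul_nonneg (by linarith : (0:ℝ) ≤ τ - 2)
      (by nlinarith : (0:ℝ) ≤ 3 * Θ + 3 - (Θ - 1) * (2 * Θ + 3))]
  have hx : 2 * τ ≤ Θ * τ := by nlinarith
  -- From `Θ * τ - 1`, the point `w` is closer than `-(τ + 1)` by exactly `1`, so visiting `w` first
  -- is strictly better. The final request appears at `m + 1`, just when the offline server reaches
  -- `a`.
  let w := (2 * Θ + 1) * τ - 2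
  let a := m + 1 - 2 * (τ + 1)
  refine ⟨decoy Θ (n + 1) (τ + 1) w w a (m + 1), m + 1, by nlinarith, ?_, ?_⟩
  · refine decoy_opt_le_of_point hc (by linarith) ?_ ?_ ?_ ?_
    · rw [Nat.add_sub_cancel]; linarith
    · rw [hK]; linarith
    · linarith
    · ring
  · have hrun := (hA (decoy Θ (n + 1) (τ + 1) w w a (m + 1))).decoy_le
      (m := m) (ℓ := (3 * Θ + 3) * τ - 2) hc (by linarith) le_rfl (Nat.add_one_ne_zero n)
      (fun k hk => by
        linarith [pow_le_pow_right₀ (by linarith : 1 ≤ Θ) (by omega : k ≤ n)])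
      (by rw [hK]; exact hm₁) (by linarith) hm.ge (.inr hm.le) (by linarith) (by
        rw [hK, sub_self, abs_zero, abs_of_nonneg, abs_of_nonneg] <;> linarith) (by
        rw [hK, abs_of_nonneg, abs_of_nonneg] <;> linarith)
    refine le_trans ?_ hrun
    rw [abs_of_nonneg (by linarith)]
    have h3 : τ = ((Θ - 1) * m + 2) / (3 * Θ + 3) := by
      rw [eq_div_iff (by linarith)]; linarith
    have h4 : f₂ Θ * (m + 1) - (f₂ Θ + 2 / (3 * Θ + 3)) = (Θ + 1) * m - τ := by
      rw [h3]
      unfold f₂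
      have : (3 * Θ + 3) ≠ 0 := by linarith
      field_simp
      ring
    rw [h4]
    linarith

/-- A single leading request suffices. The ride makes Smartstart turn back to `α` and return to `q -
1` before going left, while it lies on the offline server's way. -/
theorem le_competitiveRatio_of_large (hc : 1 ≤ c) (hΘ : 9 / 4 ≤ Θ) {A : Input → ℝ}
    (hA : IsSmartstart c Θ A) : ENNReal.ofReal 2.94 ≤ competitiveRatio c A := by
  have hΘ0 : 0 < Θ - 1 := by linarith
  obtain ⟨q, hq1, hq2, hqΘ, hq3⟩ : ∃ q : ℝ, 9 / 4 ≤ q ∧ q ≤ 3 ∧ q ≤ Θ ∧ (q = Θ ∨ q = 3) := by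
    rcases le_total Θ 3 with h | h
    · exact ⟨Θ, hΘ, h, le_rfl, .inl rfl⟩
    · exact ⟨3, by norm_num, le_rfl, h, .inr rfl⟩
  let m := max q (2 * q / (Θ - 1))
  have hm₁ : q ≤ m := le_max_left _ _
  have hm₂ : 2 * q / (Θ - 1) ≤ m := le_max_right _ _
  have hm₃ : m ≤ q ∨ (Θ - 1) * m ≤ 2 * q := by
    rcases le_total q (2 * q / (Θ - 1)) with h | h
    · refine .inr (le_of_eq ?_)
      simp only [m]
      rw [max_eq_right h]
      field_simp
    · exact .inl (max_le le_rfl h)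
  rw [div_le_iff₀ hΘ0] at hm₂
  have hm₄ : 3 ≤ m := by
    rcases hq3 with rfl | rfl
    · nlinarith
    · exact hm₁
  -- This is `hr₃` with `r = m + 0.01`; the target `1.94 * r` arises because the final crossing
  -- already contributes one `r` to the cost.
  have hm₅ : 0.94 * m ≤ 2 * q - 1.0294 := by
    rcases hm₃ with h | h
    · linarith
    · nlinarith
  let r := max (m + 0.01) (2 * 1.01 + (q - 1))
  have hr₁ : m + 0.01 ≤ r := le_max_left _ _
  have hr₂ : 2 * 1.01 + (q - 1) ≤ r := le_max_right _ _
  have hr₃ : 1.94 * r ≤ m + 2 * q - 1.01 := by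
    rcases le_total (m + 0.01) (2 * 1.01 + (q - 1)) with h | h
    · simp only [r]
      rw [max_eq_right h]
      linarith
    · simp only [r]
      rw [max_eq_left h]
      linarith
  -- With this `α` the decoy costs exactly `2 * q`, which is `0.02` less than the lower bound `2 * q
  -- + 0.02` for the other order.
  let α := q / 2 - 1 + 0.005
  refine le_competitiveRatio fun r' hr' =>
    ⟨decoy q 1 1.01 α (q - 1) (r - 2 * 1.01) r, r, by linarith, ?_, ?_⟩
  · exact decoy_opt_le_of_ride hc (by linarith) (by norm_num) (by simp only [α]; linarith)
      (by simp only [α]; linarith) (by linarith) (by ring)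
  · have hrun := (hA (decoy q 1 1.01 α (q - 1) (r - 2 * 1.01) r)).decoy_le
      (m := m) (ℓ := 2 * q) hc (by linarith) hqΘ one_ne_zero (fun k hk => by
        obtain rfl : k = 0 := by omega
        norm_num)
      (by rw [pow_one]; exact hm₁) (by linarith) (by linarith) (by rw [pow_one]; exact hm₃)
      (by linarith) (by
        rw [pow_one, abs_of_nonpos (by simp only [α]; linarith),
          abs_of_nonneg (by simp only [α]; linarith), abs_of_nonneg (by linarith)]
        simp only [α]
        ring) (by
        rw [pow_one, abs_of_nonneg (by linarith)]
        linarith)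
    refine le_trans ?_ hrun
    rw [abs_of_nonneg (by linarith)]
    nlinarith

end DialARide

/-! ### The functions `f₁` and `f₂` -/

namespace DialARide

open scoped ENNReal

theorem f₁_lt_f₁ {x y : ℝ} (hx : 1 < x) (hxy : x < y) : f₁ y < f₁ x := by
  unfold f₁
  rw [div_lt_div_iff₀ (by nlinarith) (by nlinarith)]
  nlinarith [mul_pos (sub_pos.2 hxy) (by linarith : 0 < x + y + 1)]

theorem f₂_lt_f₂ {x y : ℝ} (hx : 0 < x) (hxy : x < y) : f₂ x < f₂ y := by
  have h (z : ℝ) (hz : 0 < z) : f₂ z = z + 2 / 3 + 2 / (3 * z + 3) := by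
    unfold f₂
    have : 3 * z + 3 ≠ 0 := by linarith
    field_simp
    ring
  rw [h x hx, h y (hx.trans hxy)]
  have h1 : 2 / (3 * x + 3) - 2 / (3 * y + 3) < y - x := by
    rw [div_sub_div _ _ (by linarith) (by linarith), div_lt_iff₀ (by nlinarith)]
    nlinarith [mul_pos (sub_pos.2 hxy) hx, mul_pos (sub_pos.2 hxy) (hx.trans hxy),
      mul_pos (sub_pos.2 hxy) (mul_pos hx (hx.trans hxy))]
  linarith

theorem one_lt_of_f₁_eq_f₂ {x : ℝ} (hx : 0 < x) (h : f₁ x = f₂ x) : 1 < x := by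
  by_contra! hx1
  have h1 : 0 < f₂ x := by
    unfold f₂
    have : (x - 1) / (3 * x + 3) ≤ 0 := div_nonpos_of_nonpos_of_nonneg (by linarith) (by linarith)
    linarith
  have h2 : f₁ x ≤ 0 := div_nonpos_of_nonneg_of_nonpos (by positivity) (by nlinarith)
  linarith

theorem eq_of_f₁_eq_f₂ {x y : ℝ} (hx : 0 < x) (hy : 0 < y) (h : f₁ x = f₂ x)
    (h' : f₁ y = f₂ y) : x = y := by
  have hx1 := one_lt_of_f₁_eq_f₂ hx h
  have hy1 := one_lt_of_f₁_eq_f₂ hy h'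
  rcases lt_trichotomy x y with hlt | heq | hlt
  · linarith [f₁_lt_f₁ hx1 hlt, f₂_lt_f₂ hx hlt]
  · exact heq
  · linarith [f₁_lt_f₁ hy1 hlt, f₂_lt_f₂ hy hlt]

theorem exists_f₁_eq_f₂ : ∃ x : ℝ, 2.0526185 < x ∧ x < 2.0526186 ∧ f₁ x = f₂ x := by
  -- The quartic is the equation `f₁ x = f₂ x` with denominators cleared.
  have hcont : ContinuousOn (fun x : ℝ => 3 * x ^ 4 + 2 * x ^ 3 - 9 * x ^ 2 - 12 * x - 8)
      (Set.Icc 2.0526185 2.0526186) := by fun_prop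
  obtain ⟨x, hx, h⟩ := intermediate_value_Ioo (by norm_num) hcont
    (show (0 : ℝ) ∈ Set.Ioo _ _ by constructor <;> norm_num)
  refine ⟨x, hx.1, hx.2, ?_⟩
  have h1 : 2 < x := by linarith [hx.1]
  have h2 : x ^ 2 + x - 2 ≠ 0 := by nlinarith
  have h3 : 3 * x + 3 ≠ 0 := by linarith
  unfold f₁ f₂
  rw [div_eq_iff h2, sub_mul, div_mul_eq_mul_div, eq_sub_iff_add_eq, ← eq_sub_iff_add_eq',
    div_eq_iff h3]
  simp only at h
  linear_combination -h

end DialARide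

theorem mainTheorem1 :
    ∃ Θs ρs : ℝ,
      -- `Θs` is the only positive solution of `f₁ Θ = f₂ Θ`, and `ρs` is the common value
      (∀ Θ : ℝ, (0 < Θ ∧ DialARide.f₁ Θ = DialARide.f₂ Θ) ↔ Θ = Θs) ∧
      ρs = DialARide.f₁ Θs ∧ ρs = DialARide.f₂ Θs ∧
      |Θs - 2.0526| < 0.00005 ∧ |ρs - 2.93768| < 0.000005 ∧
      ∀ c : ℕ∞, 1 ≤ c →
        -- Smartstart is well defined
        (∀ Θ : ℝ, 1 < Θ → ∃ A, DialARide.IsSmartstart c Θ A) ∧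
        -- the competitive ratio for `Θs` is exactly `ρs`
        (∀ A, DialARide.IsSmartstart c Θs A →
          DialARide.competitiveRatio c A = ENNReal.ofReal ρs) ∧
        -- the competitive ratio for every other parameter is strictly larger
        (∀ Θ : ℝ, 1 < Θ → Θ ≠ Θs → ∀ A, DialARide.IsSmartstart c Θ A →
          ENNReal.ofReal ρs < DialARide.competitiveRatio c A) := by
  obtain ⟨x, hx1, hx2, hx⟩ := DialARide.exists_f₁_eq_f₂
  -- Monotonicity of `f₂` turns the enclosure of `x` into one of `ρ*`.
  have hρ1 : 2.937675 < DialARide.f₂ x := by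
    refine lt_trans ?_ (DialARide.f₂_lt_f₂ (by norm_num) hx1)
    norm_num [DialARide.f₂]
  have hρ2 : DialARide.f₂ x < 2.937685 := by
    refine (DialARide.f₂_lt_f₂ (by linarith) hx2).trans ?_
    norm_num [DialARide.f₂]
  have hρ0 : 0 ≤ DialARide.f₂ x := by linarith
  refine ⟨x, DialARide.f₂ x, fun Θ => ⟨fun h => ?_, ?_⟩, hx.symm, rfl, ?_, ?_, fun c hc =>
    ⟨fun Θ hΘ => DialARide.exists_isSmartstart hc hΘ, fun A hA => ?_, fun Θ hΘ hne A hA => ?_⟩⟩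
  · exact DialARide.eq_of_f₁_eq_f₂ h.1 (by linarith) h.2 hx
  · rintro rfl
    exact ⟨by linarith, hx⟩
  · rw [abs_lt]; constructor <;> linarith
  · rw [abs_lt]; constructor <;> linarith
  · refine le_antisymm (sInf_le fun σ => ?_) ?_
    · rw [← ENNReal.ofReal_mul hρ0]
      exact ENNReal.ofReal_le_ofReal
        (hA.le_mul_opt hc (by linarith) hx.le le_rfl (by linarith) σ)
    · rw [← hx]
      exact DialARide.f₁_le_competitiveRatio hc (by linarith) hA
  · rcases lt_or_gt_of_ne hne with hlt | hgt
    · refine lt_of_lt_of_le ?_ (DialARide.f₁_le_competitiveRatio hc hΘ hA)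
      have := DialARide.f₁_lt_f₁ hΘ hlt
      exact (ENNReal.ofReal_lt_ofReal_iff (by linarith)).2 (by linarith)
    -- Above `9 / 4` the bound `2.94` takes over from `f₂ Θ`; it still exceeds `ρ* < 2.937685`.
    · rcases le_total Θ (9 / 4) with hle | hle
      · refine lt_of_lt_of_le ?_ (DialARide.f₂_le_competitiveRatio hc (by linarith) hle hA)
        have := DialARide.f₂_lt_f₂ (by linarith) hgt
        exact (ENNReal.ofReal_lt_ofReal_iff (by linarith)).2 this
      · refine lt_of_lt_of_le ?_ (DialARide.le_competitiveRatio_of_large hc hle hA)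
        exact (ENNReal.ofReal_lt_ofReal_iff (by norm_num)).2 (by linarith)
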